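/- Consider on $\mathbb{R}^7\ni(\Sigma_1,\Sigma_2,\Sigma_3,R_1,R_3,N_-,A)$, with $\Sigma^2:=\tfrac16(\Sigma_1^2+\Sigma_2^2+\Sigma_3^2)+R_1^2+R_3^2$, the evolution equations of the Bianchi type $\mathrm{VI}_{-1/9}$ vacuum models (time $\tau$ directed toward the past singularity) \begin{align*} \Sigma_1'&=2(1-\Sigma^2)\Sigma_1-6R_3^2+8N_-^2,\\ \Sigma_2'&=2(1-\Sigma^2)\Sigma_2+6R_3^2-6R_1^2-4N_-^2+3A^2,\\ \Sigma_3'&=2(1-\Sigma^2)\Sigma_3+6R_1^2-4N_-^2-3A^2,\\ R_1'&=[2(1-\Sigma^2)+\Sigma_2-\Sigma_3]R_1,\\ R_3'&=[2(1-\Sigma^2)+\Sigma_1-\Sigma_2]R_3-4N_-A,\\ N_-'&=-2(\Sigma^2+\Sigma_1)N_-+3R_3A,\\ A'&=-(2\Sigma^2-\Sigma_3)A, \end{align*} on the state space given by $1-\Sigma^2-N_-^2-A^2=0$, $2R_3N_-+\Sigma_1A=0$, $\Sigma_1+\Sigma_2+\Sigma_3=0$, $R_1\ge0$, $A\ge0$.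 Let $\mathcal{HO}$ be the two-dimensional subset of the state space on which $\Sigma_1=R_3=N_-=0$; call the part with $R_1>0$ and $A>0$ its interior, and the part with $R_1=0$ or $A=0$ its boundary. Let \begin{align*} \mathrm{RT}&=\Bigl(0,-\tfrac23,\tfrac23,\tfrac{\sqrt5}{3\sqrt3},0,0,\sqrt{\tfrac23}\Bigr),& \mathrm{PW}^0&=\bigl(0,-\tfrac32,\tfrac32,0,0,0,\tfrac12\bigr),& \mathrm{K}_\pm&=(0,\pm\sqrt3,\mp\sqrt3,0,0,0,0). \end{align*} Then $\mathcal{HO}$ is invariant: through each of its points there passes exactly one solution defined for all $\tau\in\mathbb{R}$, and this solution stays in $\mathcal{HO}$. The fixed points in $\mathcal{HO}$ are exactly $\mathrm{RT}$, $\mathrm{PW}^0$, $\mathrm{K}_+$, $\mathrm{K}_-$. There is exactly one heteroclinic orbit in $\mathcal{HO}$ of each of the types $\mathrm{K}_+\to\mathrm{K}_-$, $\mathrm{PW}^0\to\mathrm{K}_+$, $\mathrm{PW}^0\to\mathrm{K}_-$ and $\mathrm{RT}\to\mathrm{PW}^0$ (where $p\to q$ means an orbit with $\alpha$-limit set $\{p\}$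 and $\omega$-limit set $\{q\}$); the first three lie in the boundary of $\mathcal{HO}$, the last one in its interior. Every orbit in $\mathcal{HO}$ other than the fixed points and these four heteroclinic orbits has the $\alpha$-limit set $\{\mathrm{RT}\}$ and the $\omega$-limit set $\{\mathrm{K}_-\}$. -/

import Mathlib

open Filter Topology

noncomputable section

namespace BianchiVI

/-- The ambient space of the Hubble-normalized variables, in the order
`(Σ₁, Σ₂, Σ₃, R₁, R₃, N₋, A)`. -/
abbrev State : Type := Fin 7 → ℝ

abbrev State.S1 (p : State) : ℝ := p 0
abbrev State.S2 (p : State) : ℝ := p 1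
abbrev State.S3 (p : State) : ℝ := p 2
abbrev State.R1 (p : State) : ℝ := p 3
abbrev State.R3 (p : State) : ℝ := p 4
abbrev State.N (p : State) : ℝ := p 5
abbrev State.A (p : State) : ℝ := p 6

/-- The quantity `Σ² = (Σ₁² + Σ₂² + Σ₃²)/6 + R₁² + R₃²`. -/
def shearSq (p : State) : ℝ :=
  (p.S1 ^ 2 + p.S2 ^ 2 + p.S3 ^ 2) / 6 + p.R1 ^ 2 + p.R3 ^ 2

/-- The right-hand side of the evolution equations of the Bianchi type VI₋₁/₉ vacuum models
(time is directed toward the past singularity). -/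
def vectorField (p : State) : State :=
  ![2 * (1 - shearSq p) * p.S1 - 6 * p.R3 ^ 2 + 8 * p.N ^ 2,
    2 * (1 - shearSq p) * p.S2 + 6 * p.R3 ^ 2 - 6 * p.R1 ^ 2 - 4 * p.N ^ 2 + 3 * p.A ^ 2,
    2 * (1 - shearSq p) * p.S3 + 6 * p.R1 ^ 2 - 4 * p.N ^ 2 - 3 * p.A ^ 2,
    (2 * (1 - shearSq p) + p.S2 - p.S3) * p.R1,
    (2 * (1 - shearSq p) + p.S1 - p.S2) * p.R3 - 4 * p.N * p.A,
    -2 * (shearSq p + p.S1) * p.N + 3 * p.R3 * p.A,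
    -(2 * shearSq p - p.S3) * p.A]

/-- The state space: the Gauss, Codazzi and trace constraints, with `R₁ ≥ 0` and `A ≥ 0`. -/
def stateSpace : Set State :=
  {p | 1 - shearSq p - p.N ^ 2 - p.A ^ 2 = 0 ∧
       2 * p.R3 * p.N + p.S1 * p.A = 0 ∧
       p.S1 + p.S2 + p.S3 = 0 ∧
       0 ≤ p.R1 ∧ 0 ≤ p.A}

/-- The hypersurface orthogonal subset `HO`. -/
def HO : Set State :=
  {p | p ∈ stateSpace ∧ p.S1 = 0 ∧ p.R3 = 0 ∧ p.N = 0}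

/-- The interior of `HO`: `R₁ > 0` and `Σ² < 1`, that is, `A > 0`. -/
def HOInterior : Set State :=
  {p | p ∈ HO ∧ 0 < p.R1 ∧ 0 < p.A}

/-- The boundary of `HO`: `R₁ = 0` or `A = 0`. -/
def HOBoundary : Set State :=
  {p | p ∈ HO ∧ (p.R1 = 0 ∨ p.A = 0)}

/-- The Robinson–Trautman fixed point. -/
def RT : State :=
  ![0, -(2 / 3), 2 / 3, √5 / (3 * √3), 0, 0, √(2 / 3)]

/-- The plane wave fixed point with `Σ₁ = 0`. -/
def PW0 : State :=
  ![0, -(3 / 2), 3 / 2, 0, 0, 0, 1 / 2]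

/-- The Kasner fixed point with `Σ₂ = -Σ₃ = √3`. -/
def KPlus : State :=
  ![0, √3, -√3, 0, 0, 0, 0]

/-- The Kasner fixed point with `Σ₂ = -Σ₃ = -√3`. -/
def KMinus : State :=
  ![0, -√3, √3, 0, 0, 0, 0]

/-- `x` is a solution, defined for all times, of the evolution equations. -/
def IsSolution (x : ℝ → State) : Prop :=
  ∀ t : ℝ, HasDerivAt x (vectorField (x t)) t

/-- `x` is a solution, defined for all times, that lies in `HO`. -/
def IsHOSolution (x : ℝ → State) : Prop :=
  IsSolution x ∧ ∀ t : ℝ, x t ∈ HO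

/-- The `α`-limit set: all limits of `x (tₙ)` along sequences `tₙ → -∞`. -/
def alphaLimitSet (x : ℝ → State) : Set State :=
  {p | MapClusterPt p atBot x}

/-- The `ω`-limit set: all limits of `x (tₙ)` along sequences `tₙ → +∞`. -/
def omegaLimitSet (x : ℝ → State) : Set State :=
  {p | MapClusterPt p atTop x}

/-- The set `O` is an orbit in `HO` with `α`-limit set `{p}` and `ω`-limit set `{q}`. -/
def IsHOConnection (p q : State) (O : Set State) : Prop :=
  ∃ x : ℝ → State, IsHOSolution x ∧ Set.range x = O ∧
    alphaLimitSet x = {p} ∧ omegaLimitSet x = {q}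

end BianchiVI

end

/-! On `HO` the constraints leave `u = Σ₃`, `R = R₁` and `A` with `u²/3 + R² + A² = 1`: a lune with
edges `R = 0` and `A = 0` that meet at `K₊` and `K₋`. `R` and `A` solve linear homogeneous
equations, so each of them is identically zero or positive throughout. Lifted to angles on the
ellipsoid, the flow is generated by a bounded smooth field and is therefore complete; solutions are
unique because the full vector field is `C¹`.

On the edges `u` is monotone: `u' = 6R²` on `A = 0` and `u' = (2u - 3)A²` on `R = 0`. Hence `u`
converges, Barbălat's lemma gives `u' → 0`, and the limits are the fixed points of the edge.

In the interior, `W = 5 log R + 18 log A - 23 log (9 - 2u)` has `W' = -12(3u - 2)²/(9 - 2u) ≤ 0`.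
Since `W` is bounded above, it converges at `-∞`; so `u → 2/3` and the α-limit is `RT`. At `+∞`,
either `W` converges, which forces the solution to be `RT`, or `W → -∞` and `RA → 0`.

The value `u = 3/2` decides the future. At `u = 3/2` one has `u' = 6R²`, so interior solutions cross
it only upwards, and beyond it they tend to `K₋` (`tendsto_KMinus_of_lt`). If `u < 3/2` forever and
the solution is not `RT`, then `(log (R/A))' = 2 - 3u` and `RA → 0` force `u > 2/3` eventually, then
`R → 0` and convergence to `PW⁰` (`tendsto_PW0`).

It remains to see that exactly one interior orbit ends at `PW⁰`. Existence (`exists_tendsto_PW0`) is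
a compactness argument: solutions that pass ever closer to `PW⁰` are traced back to `R = 1/3`, and a
limit of these starting points never gets past `u = 3/2`. Uniqueness (`u_eq_of_R_eq`) is a cone
argument at the saddle: two solutions with equal `R` and different `u` separate, so they cannot both
converge to `PW⁰`. -/

namespace BianchiVI

/-! ### Differential equations: uniqueness, completeness, continuous dependence. -/

open Set in
/-- Global solutions of an autonomous `C¹` differential equation that meet are equal. -/
theorem eq_of_hasDerivAt_of_contDiff {E : Type*} [NormedAddCommGroup E] [NormedSpace ℝ E]
    [CompleteSpace E] {v : E → E} (hv : ContDiff ℝ 1 v) {x y : ℝ → E}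
    (hx : ∀ t, HasDerivAt x (v (x t)) t) (hy : ∀ t, HasDerivAt y (v (y t)) t) {t₀ : ℝ}
    (h : x t₀ = y t₀) : x = y := by
  have hv' : ContMDiff (modelWithCornersSelf ℝ E) (modelWithCornersSelf ℝ E).tangent 1
      (fun z => (⟨z, v z⟩ : TangentBundle (modelWithCornersSelf ℝ E) E)) :=
    contMDiff_vectorSpace_iff_contDiff.2 hv
  refine isMIntegralCurve_Ioo_eq_of_contMDiff_boundaryless (t₀ := t₀)
    (I := modelWithCornersSelf ℝ E) hv' ?_ ?_ h
  · exact fun t => (hx t).hasFDerivAt.hasMFDerivAt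
  · exact fun t => (hy t).hasFDerivAt.hasMFDerivAt

open Set in
/-- A bounded `C¹` vector field on a finite-dimensional space is complete. -/
theorem exists_forall_hasDerivAt_of_bounded {E : Type*} [NormedAddCommGroup E] [NormedSpace ℝ E]
    [ProperSpace E] {v : E → E} (hv : ContDiff ℝ 1 v) {C : ℝ} (hC : ∀ z, ‖v z‖ ≤ C) (z : E) :
    ∃ x : ℝ → E, x 0 = z ∧ ∀ t, HasDerivAt x (v (x t)) t := by
  have : CompleteSpace E := inferInstance
  have hv' : ContMDiff (modelWithCornersSelf ℝ E) (modelWithCornersSelf ℝ E).tangent 1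
      (fun z => (⟨z, v z⟩ : TangentBundle (modelWithCornersSelf ℝ E) E)) :=
    contMDiff_vectorSpace_iff_contDiff.2 hv
  have hC0 : 0 ≤ C := (norm_nonneg _).trans (hC z)
  obtain ⟨x, hx0, hx⟩ := (exists_isMIntegralCurve_iff_exists_isMIntegralCurveOn_Ioo
    (I := modelWithCornersSelf ℝ E) hv' z).2 (by
      intro T
      rcases le_or_gt T 0 with hT | hT
      · refine ⟨fun _ => z, rfl, fun t ht => ?_⟩
        exact absurd (ht.1.trans ht.2) (by linarith)
      lift C to NNReal using hC0
      obtain ⟨K, hK⟩ := (hv.locallyLipschitz.locallyLipschitzOn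
        (s := Metric.closedBall z ((C * ⟨T, hT.le⟩ : NNReal) : ℝ))).exists_lipschitzOnWith_of_compact
        (isCompact_closedBall _ _)
      -- At speed at most `C` a solution cannot leave the ball of radius `C * T` before time `T`, so
      -- Picard–Lindelöf works on all of `[-T, T]`.
      have hpl : IsPicardLindelof (fun _ => v) (tmin := -T) (tmax := T)
          ⟨0, by constructor <;> linarith⟩ z (C * ⟨T, hT.le⟩) 0 C K :=
        IsPicardLindelof.of_time_independent (fun w _ => hC w) hK
          (by simp; exact le_rfl)
      obtain ⟨α, h0, hα⟩ := hpl.exists_eq_forall_mem_Icc_hasDerivWithinAt₀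
      refine ⟨α, h0, fun t ht => ?_⟩
      exact ((hα t (Ioo_subset_Icc_self ht)).hasDerivAt
        (Icc_mem_nhds ht.1 ht.2)).hasFDerivAt.hasMFDerivAt.hasMFDerivWithinAt)
  refine ⟨x, hx0, fun t => ?_⟩
  have h : HasFDerivAt x (ContinuousLinearMap.smulRight (1 : ℝ →L[ℝ] ℝ) (v (x t))) t :=
    hasMFDerivAt_iff_hasFDerivAt.1 (hx t)
  simpa using h.hasDerivAt

open Set in
/-- Continuous dependence on the initial value, for solutions in a compact set. -/
theorem tendsto_of_hasDerivAt_of_isCompact {E : Type*} [NormedAddCommGroup E] [NormedSpace ℝ E]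
    {v : E → E} (hv : ContDiff ℝ 1 v) {s : Set E} (hs : IsCompact s) {x : ℕ → ℝ → E} {y : ℝ → E}
    (hx : ∀ n t, HasDerivAt (x n) (v (x n t)) t) (hxs : ∀ n t, x n t ∈ s)
    (hy : ∀ t, HasDerivAt y (v (y t)) t) (hys : ∀ t, y t ∈ s)
    (h0 : Tendsto (fun n => x n 0) atTop (𝓝 (y 0))) {t : ℝ} (ht : 0 ≤ t) :
    Tendsto (fun n => x n t) atTop (𝓝 (y t)) := by
  obtain ⟨K, hK⟩ := (hv.locallyLipschitz.locallyLipschitzOn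
    (s := s)).exists_lipschitzOnWith_of_compact hs
  have key : ∀ n, dist (x n t) (y t) ≤ dist (x n 0) (y 0) * Real.exp (K * (t - 0)) := fun n =>
    dist_le_of_trajectories_ODE_of_mem (v := fun _ => v) (s := fun _ => s) (fun _ _ => hK)
      (fun τ _ => (hx n τ).continuousAt.continuousWithinAt) (fun τ _ => (hx n τ).hasDerivWithinAt)
      (fun τ _ => hxs n τ)
      (fun τ _ => (hy τ).continuousAt.continuousWithinAt) (fun τ _ => (hy τ).hasDerivWithinAt)
      (fun τ _ => hys τ) le_rfl t ⟨ht, le_rfl⟩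
  rw [tendsto_iff_dist_tendsto_zero] at h0 ⊢
  refine squeeze_zero (fun _ => dist_nonneg) key ?_
  simpa using h0.mul_const (Real.exp (K * (t - 0)))

/-! ### Real analysis: Barbălat's lemma, comparison, scalar linear equations. -/

/-- **Barbălat's lemma** at `+∞`, for a bounded second derivative. -/
theorem tendsto_deriv_atTop_of_bounded {f g h : ℝ → ℝ} (hf : ∀ t, HasDerivAt f (g t) t)
    (hg : ∀ t, HasDerivAt g (h t) t) {C : ℝ} (hC : ∀ t, |h t| ≤ C) {L : ℝ}
    (hL : Tendsto f atTop (𝓝 L)) : Tendsto g atTop (𝓝 0) := by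
  have hC0 : 0 ≤ C := (abs_nonneg _).trans (hC 0)
  have hlip : ∀ s t, |g s - g t| ≤ C * |s - t| := fun s t => by
    simpa using Convex.norm_image_sub_le_of_norm_hasDerivWithin_le (s := Set.univ)
      (fun τ _ => (hg τ).hasDerivWithinAt) (fun τ _ => hC τ) convex_univ (Set.mem_univ t)
      (Set.mem_univ s)
  rw [Metric.tendsto_nhds]
  intro ε hε
  -- On an interval of this length `g` varies by at most `ε / 2`; `C + 1` avoids division by zero.
  set δ := ε / (2 * (C + 1)) with hδ
  have hδ0 : 0 < δ := by positivity
  have hdiff : Tendsto (fun t => f (t + δ) - f t) atTop (𝓝 0) := by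
    simpa using (hL.comp (tendsto_atTop_add_const_right _ δ tendsto_id)).sub hL
  filter_upwards [(Metric.tendsto_nhds.1 hdiff) (δ * (ε / 2)) (by positivity)] with t ht
  obtain ⟨c, hc, hc'⟩ := exists_hasDerivAt_eq_slope f g (show t < t + δ by linarith)
    (fun τ _ => (hf τ).continuousAt.continuousWithinAt) (fun τ _ => hf τ)
  have h1 : |g c| < ε / 2 := by
    rw [hc', abs_div, show t + δ - t = δ by ring, abs_of_pos hδ0, div_lt_iff₀ hδ0]
    simpa [Real.dist_eq, mul_comm] using ht
  have h2 : |g t - g c| ≤ ε / 2 := by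
    refine (hlip t c).trans ?_
    have : |t - c| ≤ δ := by rw [abs_le]; constructor <;> linarith [hc.1, hc.2]
    calc C * |t - c| ≤ (C + 1) * δ := by gcongr; linarith
      _ = ε / 2 := by rw [hδ]; field_simp
  rw [Real.dist_eq, sub_zero]
  calc |g t| = |(g t - g c) + g c| := by ring_nf
    _ ≤ |g t - g c| + |g c| := abs_add_le _ _
    _ < ε := by linarith

/-- **Barbălat's lemma** at `-∞`, for a bounded second derivative. -/
theorem tendsto_deriv_atBot_of_bounded {f g h : ℝ → ℝ} (hf : ∀ t, HasDerivAt f (g t) t)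
    (hg : ∀ t, HasDerivAt g (h t) t) {C : ℝ} (hC : ∀ t, |h t| ≤ C) {L : ℝ}
    (hL : Tendsto f atBot (𝓝 L)) : Tendsto g atBot (𝓝 0) := by
  have hneg : ∀ t : ℝ, HasDerivAt (fun s : ℝ => -s) (-1) t := fun t => (hasDerivAt_id t).neg
  have h1 : ∀ t, HasDerivAt (fun s => f (-s)) (-g (-t)) t := fun t => by
    simpa [Function.comp_def] using (hf (-t)).comp t (hneg t)
  have h2 : ∀ t, HasDerivAt (fun s => -g (-s)) (h (-t)) t := fun t => by
    simpa [Function.comp_def] using! ((hg (-t)).comp t (hneg t)).neg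
  have h3 := tendsto_deriv_atTop_of_bounded h1 h2 (fun t => hC (-t))
    (hL.comp tendsto_neg_atTop_atBot)
  simpa [Function.comp_def] using (h3.comp tendsto_neg_atBot_atTop).neg

/-- A differentiable function that increases whenever it equals `c` does not fall below `c`. -/
theorem le_of_deriv_pos_of_eq {f f' : ℝ → ℝ} {a b c : ℝ} (hf : ∀ t, HasDerivAt f (f' t) t)
    (ha : c ≤ f a) (h : ∀ t, a ≤ t → t < b → f t = c → 0 < f' t) :
    ∀ t, a ≤ t → t ≤ b → c ≤ f t := fun _ h1 h2 =>
  image_le_of_deriv_right_lt_deriv_boundary (f := fun _ => c) (f' := fun _ => 0)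
    continuousOn_const (fun x _ => hasDerivWithinAt_const x _ c) ha hf
    (fun x hx hfx => h x hx.1 hx.2 hfx.symm) ⟨h1, h2⟩

/-- A differentiable function that decreases whenever it equals `c` does not rise above `c`. -/
theorem le_of_deriv_neg_of_eq {f f' : ℝ → ℝ} {a b c : ℝ} (hf : ∀ t, HasDerivAt f (f' t) t)
    (ha : f a ≤ c) (h : ∀ t, a ≤ t → t < b → f t = c → f' t < 0) :
    ∀ t, a ≤ t → t ≤ b → f t ≤ c := fun t h1 h2 => by
  have := le_of_deriv_pos_of_eq (c := -c) (b := b) (fun t => (hf t).neg) (neg_le_neg ha)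
    (fun t h1 h2 h3 => neg_pos.2 (h t h1 h2 (neg_injective h3))) t h1 h2
  exact neg_le_neg_iff.1 this

/-- A lower bound for the derivative on an interval gives a lower bound for the growth. -/
theorem add_mul_le_of_le_deriv {f f' : ℝ → ℝ} {a b c : ℝ} (hf : ∀ t, HasDerivAt f (f' t) t)
    (hab : a ≤ b) (h : ∀ t, a ≤ t → t < b → c ≤ f' t) : f a + c * (b - a) ≤ f b := by
  have := image_le_of_deriv_right_le_deriv_boundary (f := fun t => f a + c * (t - a))
    (f' := fun _ => c) (a := a) (b := b) (B := f) (B' := f') (by fun_prop)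
    (fun x _ => by
      simpa using ((((hasDerivAt_id x).sub_const a).const_mul c).const_add (f a)).hasDerivWithinAt)
    (by simp) (fun x _ => (hf x).continuousAt.continuousWithinAt)
    (fun x _ => (hf x).hasDerivWithinAt) (fun x hx => h x hx.1 hx.2)
  exact this ⟨hab, le_rfl⟩

/-- The solution formula for a scalar linear homogeneous differential equation. -/
theorem eq_mul_exp_of_hasDerivAt {f g : ℝ → ℝ} (hg : Continuous g)
    (hf : ∀ t, HasDerivAt f (g t * f t) t) (s t : ℝ) :
    f t = f s * Real.exp (∫ τ in s..t, g τ) := by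
  have hG : ∀ τ, HasDerivAt (fun t => ∫ τ in s..t, g τ) (g τ) τ := fun τ =>
    intervalIntegral.integral_hasDerivAt_right (hg.intervalIntegrable _ _)
      (hg.stronglyMeasurableAtFilter _ _) hg.continuousAt
  have hd : ∀ τ, HasDerivAt (fun t => f t * Real.exp (-∫ τ in s..t, g τ)) 0 τ := fun τ => by
    convert! (hf τ).mul (hG τ).neg.exp using 1
    ring
  have := is_const_of_deriv_eq_zero (fun τ => (hd τ).differentiableAt) (fun τ => (hd τ).deriv) t s
  simp only [intervalIntegral.integral_same, neg_zero, Real.exp_zero, mul_one] at this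
  rw [← this, mul_assoc, ← Real.exp_add, neg_add_cancel, Real.exp_zero, mul_one]

theorem eq_zero_of_hasDerivAt_mul {f g : ℝ → ℝ} (hg : Continuous g)
    (hf : ∀ t, HasDerivAt f (g t * f t) t) {s : ℝ} (hs : f s = 0) (t : ℝ) : f t = 0 := by
  rw [eq_mul_exp_of_hasDerivAt hg hf s t, hs, zero_mul]

theorem pos_of_hasDerivAt_mul {f g : ℝ → ℝ} (hg : Continuous g)
    (hf : ∀ t, HasDerivAt f (g t * f t) t) {s : ℝ} (hs : 0 < f s) (t : ℝ) : 0 < f t := by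
  rw [eq_mul_exp_of_hasDerivAt hg hf s t]
  exact mul_pos hs (Real.exp_pos _)

theorem setOf_mapClusterPt_eq_singleton {α X : Type*} [TopologicalSpace X] [T2Space X]
    {l : Filter α} [NeBot l] {x : α → X} {p : X} (h : Tendsto x l (𝓝 p)) :
    {q | MapClusterPt q l x} = {p} := by
  ext q
  simp only [Set.mem_ofPred_eq, Set.mem_singleton_iff]
  constructor
  · intro hq
    by_contra hne
    have hd : Disjoint (𝓝 q) (𝓝 p) := disjoint_nhds_nhds.2 hne
    exact ((hd.mono_right h).eq_bot ▸ hq.neBot).ne rfl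
  · rintro rfl
    exact h.mapClusterPt

/-! ### Reduction of `HO` to the three coordinates `Σ₃`, `R₁`, `A`. -/

theorem contDiff_vectorField : ContDiff ℝ 1 vectorField := by
  rw [contDiff_pi]
  intro i
  fin_cases i <;> simp [vectorField, shearSq] <;> fun_prop

/-- The point of `HO` with coordinates `Σ₃ = u`, `R₁ = R` and `A`. -/
def hoPoint (u R A : ℝ) : State := ![0, -u, u, R, 0, 0, A]

theorem mem_HO_iff {p : State} : p ∈ HO ↔ ∃ u R A : ℝ,
    u ^ 2 / 3 + R ^ 2 + A ^ 2 = 1 ∧ 0 ≤ R ∧ 0 ≤ A ∧ p = hoPoint u R A := by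
  constructor
  · rintro ⟨⟨h1, -, h3, h4, h5⟩, h6, h7, h8⟩
    simp only [shearSq, State.S1, State.S2, State.S3, State.R1, State.R3, State.N, State.A] at *
    have h9 : p 1 = - p 2 := by linarith
    refine ⟨p 2, p 3, p 6, ?_, h4, h5, ?_⟩
    · rw [h6, h7, h8, h9] at h1
      linarith
    · ext i
      fin_cases i <;> simp [hoPoint, h6, h7, h8, h9]
  · rintro ⟨u, R, A, h, hR, hA, rfl⟩
    simp only [HO, stateSpace, shearSq, State.S1, State.S2, State.S3, State.R1, State.R3, State.N,
      State.A, Set.mem_ofPred_eq, hoPoint]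
    simp [hR, hA]
    linarith

/-- The constraint turns `Σ²` into `1 - A²`, which makes the field polynomial of degree three. -/
theorem vectorField_hoPoint {u R A : ℝ} (h : u ^ 2 / 3 + R ^ 2 + A ^ 2 = 1) :
    vectorField (hoPoint u R A) = ![0, -(2 * A ^ 2 * u + 6 * R ^ 2 - 3 * A ^ 2),
      2 * A ^ 2 * u + 6 * R ^ 2 - 3 * A ^ 2, (2 * A ^ 2 - 2 * u) * R, 0, 0,
      (2 * A ^ 2 + u - 2) * A] := by
  have hs : shearSq (hoPoint u R A) = 1 - A ^ 2 := by
    simp [shearSq, hoPoint]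
    linarith
  ext i
  fin_cases i <;> simp [vectorField, hs] <;> simp [hoPoint] <;>
    first | ring1 | (left; ring1)

/-- A solution in `HO`, in the coordinates `Σ₃ = u`, `R₁ = R` and `A`. -/
structure RedSol (u R A : ℝ → ℝ) : Prop where
  du : ∀ t, HasDerivAt u (2 * A t ^ 2 * u t + 6 * R t ^ 2 - 3 * A t ^ 2) t
  dR : ∀ t, HasDerivAt R ((2 * A t ^ 2 - 2 * u t) * R t) t
  dA : ∀ t, HasDerivAt A ((2 * A t ^ 2 + u t - 2) * A t) t
  con : ∀ t, u t ^ 2 / 3 + R t ^ 2 + A t ^ 2 = 1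
  R_nonneg : ∀ t, 0 ≤ R t
  A_nonneg : ∀ t, 0 ≤ A t

theorem IsHOSolution.redSol {x : ℝ → State} (hx : IsHOSolution x) :
    RedSol (fun t => x t 2) (fun t => x t 3) (fun t => x t 6) ∧
      ∀ t, x t = hoPoint (x t 2) (x t 3) (x t 6) := by
  have key : ∀ t, x t 2 ^ 2 / 3 + x t 3 ^ 2 + x t 6 ^ 2 = 1 ∧ 0 ≤ x t 3 ∧ 0 ≤ x t 6 ∧
      x t = hoPoint (x t 2) (x t 3) (x t 6) := fun t => by
    obtain ⟨u, R, A, h1, h2, h3, h4⟩ := mem_HO_iff.1 (hx.2 t)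
    rw [h4]
    exact ⟨h1, h2, h3, rfl⟩
  have hd : ∀ t, HasDerivAt x ![0, -(2 * x t 6 ^ 2 * x t 2 + 6 * x t 3 ^ 2 - 3 * x t 6 ^ 2),
      2 * x t 6 ^ 2 * x t 2 + 6 * x t 3 ^ 2 - 3 * x t 6 ^ 2, (2 * x t 6 ^ 2 - 2 * x t 2) * x t 3,
      0, 0, (2 * x t 6 ^ 2 + x t 2 - 2) * x t 6] t := fun t => by
    rw [← vectorField_hoPoint (key t).1, ← (key t).2.2.2]
    exact hx.1 t
  exact ⟨⟨fun t => hasDerivAt_pi.1 (hd t) 2, fun t => hasDerivAt_pi.1 (hd t) 3,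
    fun t => hasDerivAt_pi.1 (hd t) 6, fun t => (key t).1, fun t => (key t).2.1,
    fun t => (key t).2.2.1⟩, fun t => (key t).2.2.2⟩

namespace RedSol

variable {u R A : ℝ → ℝ}

theorem isHOSolution (h : RedSol u R A) : IsHOSolution fun t => hoPoint (u t) (R t) (A t) := by
  refine ⟨fun t => ?_, fun t => mem_HO_iff.2
    ⟨_, _, _, h.con t, h.R_nonneg t, h.A_nonneg t, rfl⟩⟩
  rw [vectorField_hoPoint (h.con t), hasDerivAt_pi]
  intro i
  fin_cases i
  · exact hasDerivAt_const t 0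
  · exact (h.du t).neg
  · exact h.du t
  · exact h.dR t
  · exact hasDerivAt_const t 0
  · exact hasDerivAt_const t 0
  · exact h.dA t

theorem continuous_u (h : RedSol u R A) : Continuous u :=
  continuous_iff_continuousAt.2 fun t => (h.du t).continuousAt

theorem continuous_R (h : RedSol u R A) : Continuous R :=
  continuous_iff_continuousAt.2 fun t => (h.dR t).continuousAt

theorem continuous_A (h : RedSol u R A) : Continuous A :=
  continuous_iff_continuousAt.2 fun t => (h.dA t).continuousAt

theorem R_pos (h : RedSol u R A) {s : ℝ} (hs : 0 < R s) (t : ℝ) : 0 < R t :=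
  pos_of_hasDerivAt_mul (by have := h.continuous_u; have := h.continuous_A; fun_prop) h.dR hs t

theorem A_pos (h : RedSol u R A) {s : ℝ} (hs : 0 < A s) (t : ℝ) : 0 < A t :=
  pos_of_hasDerivAt_mul (by have := h.continuous_u; have := h.continuous_A; fun_prop) h.dA hs t

theorem R_eq_zero (h : RedSol u R A) {s : ℝ} (hs : R s = 0) (t : ℝ) : R t = 0 :=
  eq_zero_of_hasDerivAt_mul (by have := h.continuous_u; have := h.continuous_A; fun_prop) h.dR hs t

theorem A_eq_zero (h : RedSol u R A) {s : ℝ} (hs : A s = 0) (t : ℝ) : A t = 0 :=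
  eq_zero_of_hasDerivAt_mul (by have := h.continuous_u; have := h.continuous_A; fun_prop) h.dA hs t

theorem u_sq_le (h : RedSol u R A) (t : ℝ) : u t ^ 2 ≤ 3 := by
  nlinarith [h.con t, sq_nonneg (R t), sq_nonneg (A t)]

theorem abs_u_le (h : RedSol u R A) (t : ℝ) : |u t| ≤ 2 := by
  rw [abs_le]
  constructor <;> nlinarith [h.u_sq_le t]

theorem abs_R_le (h : RedSol u R A) (t : ℝ) : |R t| ≤ 1 := by
  rw [abs_le]
  constructor <;> nlinarith [h.con t, sq_nonneg (u t), sq_nonneg (A t)]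

theorem abs_A_le (h : RedSol u R A) (t : ℝ) : |A t| ≤ 1 := by
  rw [abs_le]
  constructor <;> nlinarith [h.con t, sq_nonneg (u t), sq_nonneg (R t)]

theorem mem_box (h : RedSol u R A) (t : ℝ) :
    (u t, R t, A t) ∈ Set.Icc (-2 : ℝ) 2 ×ˢ Set.Icc (-1 : ℝ) 1 ×ˢ Set.Icc (-1 : ℝ) 1 :=
  ⟨abs_le.1 (h.abs_u_le t), abs_le.1 (h.abs_R_le t), abs_le.1 (h.abs_A_le t)⟩

/-- Continuous functions of the coordinates are bounded along solutions. -/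
theorem exists_abs_le (h : RedSol u R A) {F : ℝ × ℝ × ℝ → ℝ}
    (hF : ContinuousOn F (Set.Icc (-2 : ℝ) 2 ×ˢ Set.Icc (-1 : ℝ) 1 ×ˢ Set.Icc (-1 : ℝ) 1)) :
    ∃ C, ∀ t, |F (u t, R t, A t)| ≤ C := by
  obtain ⟨C, hC⟩ :=
    (isCompact_Icc.prod (isCompact_Icc.prod isCompact_Icc)).exists_bound_of_continuousOn hF
  exact ⟨C, fun t => hC _ (h.mem_box t)⟩

/-- The second derivative of `u` is a polynomial in bounded coordinates; this is the input for
Barbălat's lemma. -/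
theorem exists_deriv_deriv_u (h : RedSol u R A) : ∃ w : ℝ → ℝ, (∀ t,
    HasDerivAt (fun t => 2 * A t ^ 2 * u t + 6 * R t ^ 2 - 3 * A t ^ 2) (w t) t) ∧
    ∃ C, ∀ t, |w t| ≤ C := by
  obtain ⟨C, hC⟩ := h.exists_abs_le (F := fun p => 2 * (2 * p.2.2 * ((2 * p.2.2 ^ 2 + p.1 - 2) *
    p.2.2)) * p.1 + 2 * p.2.2 ^ 2 * (2 * p.2.2 ^ 2 * p.1 + 6 * p.2.1 ^ 2 - 3 * p.2.2 ^ 2) +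
    6 * (2 * p.2.1 * ((2 * p.2.2 ^ 2 - 2 * p.1) * p.2.1)) -
    3 * (2 * p.2.2 * ((2 * p.2.2 ^ 2 + p.1 - 2) * p.2.2))) (by fun_prop)
  refine ⟨_, fun t => ?_, C, hC⟩
  have hA2 : HasDerivAt (fun t => A t ^ 2) _ t := (h.dA t).pow 2
  have hR2 : HasDerivAt (fun t => R t ^ 2) _ t := (h.dR t).pow 2
  convert! (((hA2.const_mul 2).mul (h.du t)).add (hR2.const_mul 6)).sub (hA2.const_mul 3) using 1
  simp

/-- If `u` converges at `+∞`, then its derivative tends to zero. -/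
theorem tendsto_deriv_u_atTop (h : RedSol u R A) {L : ℝ} (hL : Tendsto u atTop (𝓝 L)) :
    Tendsto (fun t => 2 * A t ^ 2 * u t + 6 * R t ^ 2 - 3 * A t ^ 2) atTop (𝓝 0) := by
  obtain ⟨w, hw, C, hC⟩ := h.exists_deriv_deriv_u
  exact tendsto_deriv_atTop_of_bounded h.du hw hC hL

/-- If `u` converges at `-∞`, then its derivative tends to zero. -/
theorem tendsto_deriv_u_atBot (h : RedSol u R A) {L : ℝ} (hL : Tendsto u atBot (𝓝 L)) :
    Tendsto (fun t => 2 * A t ^ 2 * u t + 6 * R t ^ 2 - 3 * A t ^ 2) atBot (𝓝 0) := by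
  obtain ⟨w, hw, C, hC⟩ := h.exists_deriv_deriv_u
  exact tendsto_deriv_atBot_of_bounded h.du hw hC hL

/-- A time translate of a solution is a solution. -/
theorem comp_add_const (h : RedSol u R A) (s : ℝ) :
    RedSol (fun t => u (t + s)) (fun t => R (t + s)) (fun t => A (t + s)) :=
  ⟨fun t => (h.du (t + s)).comp_add_const t s, fun t => (h.dR (t + s)).comp_add_const t s,
    fun t => (h.dA (t + s)).comp_add_const t s, fun _ => h.con _, fun _ => h.R_nonneg _,
    fun _ => h.A_nonneg _⟩

end RedSol

/-! ### Global existence by lifting to angles. -/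

/-- Through every point of `HO` there passes a solution. -/
theorem exists_redSol {u₀ R₀ A₀ : ℝ} (h : u₀ ^ 2 / 3 + R₀ ^ 2 + A₀ ^ 2 = 1) (hR : 0 ≤ R₀)
    (hA : 0 ≤ A₀) : ∃ u R A : ℝ → ℝ, RedSol u R A ∧ u 0 = u₀ ∧ R 0 = R₀ ∧ A 0 = A₀ := by
  have h3 : (√3 : ℝ) ^ 2 = 3 := Real.sq_sqrt (by norm_num)
  have h30 : (0 : ℝ) < √3 := by positivity
  obtain ⟨a₀, b₀, hu₀, hR₀, hA₀⟩ : ∃ a b : ℝ, √3 * Real.sin a = u₀ ∧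
      Real.cos a * Real.cos b = R₀ ∧ Real.cos a * Real.sin b = A₀ := by
    have hsq : (u₀ / √3) ^ 2 = u₀ ^ 2 / 3 := by rw [div_pow, h3]
    have hle : (u₀ / √3) ^ 2 ≤ 1 := by nlinarith [sq_nonneg R₀, sq_nonneg A₀]
    have hab := abs_le.1 ((sq_le_one_iff_abs_le_one _).1 hle)
    have hcos : Real.cos (Real.arcsin (u₀ / √3)) = ‖(⟨R₀, A₀⟩ : ℂ)‖ := by
      rw [Real.cos_arcsin, Complex.norm_def, Complex.normSq_mk]
      congr 1
      rw [hsq]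
      linarith
    -- If `R₀ = A₀ = 0`, the argument takes its default value; it is multiplied by `cos a = 0`, so
    -- any value would do.
    refine ⟨Real.arcsin (u₀ / √3), Complex.arg ⟨R₀, A₀⟩, ?_, ?_, ?_⟩
    · rw [Real.sin_arcsin hab.1 hab.2]
      field_simp
    · rw [hcos, Complex.norm_mul_cos_arg]
    · rw [hcos, Complex.norm_mul_sin_arg]
  have hb : ∀ x : ℝ, |Real.sin x| ≤ 1 ∧ |Real.cos x| ≤ 1 := fun x =>
    ⟨Real.abs_sin_le_one x, Real.abs_cos_le_one x⟩
  -- The angular velocities `(a', b')` as polynomials in the sines and cosines. The factor `cos a`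
  -- in `u'` cancels one of those from the chart, so nothing is singular at the poles.
  let F : ℝ × ℝ × ℝ × ℝ → ℝ × ℝ := fun q =>
    (q.2.1 * (2 * √3 * q.2.2.1 ^ 2 * q.1 + 6 * q.2.2.2 ^ 2 - 3 * q.2.2.1 ^ 2) * (√3 / 3),
      (3 * √3 * q.1 - 2) * q.2.2.1 * q.2.2.2)
  have hF : Continuous F := by fun_prop
  let v : ℝ × ℝ → ℝ × ℝ := fun z =>
    F (Real.sin z.1, Real.cos z.1, Real.sin z.2, Real.cos z.2)
  have hv : ContDiff ℝ 1 v := by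
    simp only [v, F]
    have h1 : ContDiff ℝ 1 fun z : ℝ × ℝ => Real.sin z.1 := Real.contDiff_sin.comp contDiff_fst
    have h2 : ContDiff ℝ 1 fun z : ℝ × ℝ => Real.sin z.2 := Real.contDiff_sin.comp contDiff_snd
    have h3 : ContDiff ℝ 1 fun z : ℝ × ℝ => Real.cos z.1 := Real.contDiff_cos.comp contDiff_fst
    have h4 : ContDiff ℝ 1 fun z : ℝ × ℝ => Real.cos z.2 := Real.contDiff_cos.comp contDiff_snd
    fun_prop
  obtain ⟨C, hC⟩ : ∃ C, ∀ z, ‖v z‖ ≤ C := by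
    have hI : IsCompact (Set.Icc (-1 : ℝ) 1) := isCompact_Icc
    obtain ⟨C, hC⟩ := (hI.prod (hI.prod (hI.prod hI))).exists_bound_of_continuousOn hF.continuousOn
    exact ⟨C, fun z => hC _ ⟨abs_le.1 (hb _).1, abs_le.1 (hb _).2, abs_le.1 (hb _).1,
      abs_le.1 (hb _).2⟩⟩
  obtain ⟨z, hz0, hz⟩ := exists_forall_hasDerivAt_of_bounded hv hC (a₀, b₀)
  have ha : ∀ t, HasDerivAt (fun t => (z t).1) (v (z t)).1 t := fun t =>
    (hz t).fst
  have hb : ∀ t, HasDerivAt (fun t => (z t).2) (v (z t)).2 t := fun t =>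
    (hz t).snd
  have hcon : ∀ t, (√3 * Real.sin (z t).1) ^ 2 / 3 +
      (Real.cos (z t).1 * Real.cos (z t).2) ^ 2 + (Real.cos (z t).1 * Real.sin (z t).2) ^ 2 = 1 :=
    fun t => by
      have e1 := Real.sin_sq_add_cos_sq (z t).1
      have e2 := Real.sin_sq_add_cos_sq (z t).2
      linear_combination (Real.cos (z t).1) ^ 2 * e2 + e1 + (Real.sin (z t).1) ^ 2 / 3 * h3
  have hdu : ∀ t, HasDerivAt (fun t => √3 * Real.sin (z t).1)
      (2 * (Real.cos (z t).1 * Real.sin (z t).2) ^ 2 * (√3 * Real.sin (z t).1) +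
        6 * (Real.cos (z t).1 * Real.cos (z t).2) ^ 2 -
        3 * (Real.cos (z t).1 * Real.sin (z t).2) ^ 2) t := fun t => by
    convert! (ha t).sin.const_mul √3 using 1
    simp only [v, F]
    linear_combination -(Real.cos (z t).1 ^ 2 * (2 * √3 * Real.sin (z t).2 ^ 2 * Real.sin (z t).1 +
      6 * Real.cos (z t).2 ^ 2 - 3 * Real.sin (z t).2 ^ 2) / 3) * h3
  have hdR : ∀ t, HasDerivAt (fun t => Real.cos (z t).1 * Real.cos (z t).2)
      ((2 * (Real.cos (z t).1 * Real.sin (z t).2) ^ 2 - 2 * (√3 * Real.sin (z t).1)) *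
        (Real.cos (z t).1 * Real.cos (z t).2)) t := fun t => by
    convert! (ha t).cos.mul (hb t).cos using 1
    simp only [v, F]
    have e1 := Real.sin_sq_add_cos_sq (z t).1
    have e2 := Real.sin_sq_add_cos_sq (z t).2
    linear_combination Real.cos (z t).1 * Real.cos (z t).2 * (2 * Real.sin (z t).2 ^ 2 * e1 +
      2 / 3 * Real.sin (z t).1 ^ 2 * Real.sin (z t).2 ^ 2 * h3 + 2 * √3 * Real.sin (z t).1 * e2)
  have hdA : ∀ t, HasDerivAt (fun t => Real.cos (z t).1 * Real.sin (z t).2)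
      ((2 * (Real.cos (z t).1 * Real.sin (z t).2) ^ 2 + √3 * Real.sin (z t).1 - 2) *
        (Real.cos (z t).1 * Real.sin (z t).2)) t := fun t => by
    convert! (ha t).cos.mul (hb t).sin using 1
    simp only [v, F]
    have e1 := Real.sin_sq_add_cos_sq (z t).1
    have e2 := Real.sin_sq_add_cos_sq (z t).2
    linear_combination Real.cos (z t).1 * Real.sin (z t).2 * (2 * Real.sin (z t).2 ^ 2 * e1 +
      2 / 3 * Real.sin (z t).1 ^ 2 * Real.sin (z t).2 ^ 2 * h3 +
      (2 - √3 * Real.sin (z t).1) * e2)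
  have hcu : Continuous fun t => √3 * Real.sin (z t).1 :=
    continuous_iff_continuousAt.2 fun t => (hdu t).continuousAt
  have hcA : Continuous fun t => Real.cos (z t).1 * Real.sin (z t).2 :=
    continuous_iff_continuousAt.2 fun t => (hdA t).continuousAt
  have hnonneg : ∀ {f g : ℝ → ℝ}, Continuous g → (∀ t, HasDerivAt f (g t * f t) t) → 0 ≤ f 0 →
      ∀ t, 0 ≤ f t := fun hg hf h0 t => by
    rw [eq_mul_exp_of_hasDerivAt hg hf 0 t]
    exact mul_nonneg h0 (Real.exp_pos _).le
  refine ⟨_, _, _, ⟨hdu, hdR, hdA, hcon, hnonneg (by fun_prop) hdR ?_,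
    hnonneg (by fun_prop) hdA ?_⟩, ?_, ?_, ?_⟩ <;> simp only [hz0] <;> simp [hu₀, hR₀, hA₀, hR, hA]

theorem RT_eq : RT = hoPoint (2 / 3) (√5 / (3 * √3)) √(2 / 3) := rfl

theorem PW0_eq : PW0 = hoPoint (3 / 2) 0 (1 / 2) := rfl

theorem KPlus_eq : KPlus = hoPoint (-√3) 0 0 := by
  ext i
  fin_cases i <;> simp [KPlus, hoPoint]

theorem KMinus_eq : KMinus = hoPoint √3 0 0 := rfl

theorem continuous_hoPoint : Continuous fun q : ℝ × ℝ × ℝ => hoPoint q.1 q.2.1 q.2.2 := by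
  refine continuous_pi fun i => ?_
  fin_cases i <;> simp [hoPoint] <;> fun_prop

theorem tendsto_hoPoint {α : Type*} {l : Filter α} {u R A : α → ℝ} {a b c : ℝ}
    (hu : Tendsto u l (𝓝 a)) (hR : Tendsto R l (𝓝 b)) (hA : Tendsto A l (𝓝 c)) :
    Tendsto (fun t => hoPoint (u t) (R t) (A t)) l (𝓝 (hoPoint a b c)) :=
  (continuous_hoPoint.tendsto (a, b, c)).comp (hu.prodMk_nhds (hR.prodMk_nhds hA))

theorem tendsto_of_tendsto_sq {α : Type*} {l : Filter α} {f : α → ℝ} {a : ℝ} (hf : ∀ t, 0 ≤ f t)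
    (ha : 0 ≤ a) (h : Tendsto (fun t => f t ^ 2) l (𝓝 (a ^ 2))) : Tendsto f l (𝓝 a) := by
  simpa [Real.sqrt_sq ha, Real.sqrt_sq (hf _)] using h.sqrt

theorem three_halves_lt_sqrt_three : (3 / 2 : ℝ) < √3 := by
  rw [Real.lt_sqrt (by norm_num)]
  norm_num

theorem abs_lt_sqrt_of_sq_lt {a b : ℝ} (h : a ^ 2 < b) : |a| < √b := by
  rw [Real.lt_sqrt (abs_nonneg a), sq_abs]
  exact h

namespace RedSol

variable {u R A : ℝ → ℝ}

/-- The derivative of `u`, as a function of `u` and `R`. -/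
theorem deriv_u_eq (h : RedSol u R A) (t : ℝ) :
    2 * A t ^ 2 * u t + 6 * R t ^ 2 - 3 * A t ^ 2 =
      (1 - u t ^ 2 / 3 - R t ^ 2) * (2 * u t - 3) + 6 * R t ^ 2 := by
  linear_combination (2 * u t - 3) * h.con t

theorem tendsto_hoPoint_of_u_R (h : RedSol u R A) {l : Filter ℝ} {a b c : ℝ}
    (hu : Tendsto u l (𝓝 a)) (hR : Tendsto R l (𝓝 b)) (hc : 0 ≤ c)
    (habc : a ^ 2 / 3 + b ^ 2 + c ^ 2 = 1) :
    Tendsto (fun t => hoPoint (u t) (R t) (A t)) l (𝓝 (hoPoint a b c)) := by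
  refine tendsto_hoPoint hu hR (tendsto_of_tendsto_sq h.A_nonneg hc ?_)
  have := ((hu.pow 2).div_const 3).const_sub 1 |>.sub (hR.pow 2)
  rw [show c ^ 2 = 1 - a ^ 2 / 3 - b ^ 2 by linarith]
  refine this.congr fun t => ?_
  linarith [h.con t]

theorem tendsto_hoPoint_of_u_A (h : RedSol u R A) {l : Filter ℝ} {a b c : ℝ}
    (hu : Tendsto u l (𝓝 a)) (hA : Tendsto A l (𝓝 c)) (hb : 0 ≤ b)
    (habc : a ^ 2 / 3 + b ^ 2 + c ^ 2 = 1) :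
    Tendsto (fun t => hoPoint (u t) (R t) (A t)) l (𝓝 (hoPoint a b c)) := by
  refine tendsto_hoPoint hu (tendsto_of_tendsto_sq h.R_nonneg hb ?_) hA
  have := ((hu.pow 2).div_const 3).const_sub 1 |>.sub (hA.pow 2)
  rw [show b ^ 2 = 1 - a ^ 2 / 3 - c ^ 2 by linarith]
  refine this.congr fun t => ?_
  linarith [h.con t]

theorem bddAbove_u (h : RedSol u R A) : BddAbove (Set.range u) :=
  ⟨2, by rintro _ ⟨t, rfl⟩; exact (abs_le.1 (h.abs_u_le t)).2⟩

theorem bddBelow_u (h : RedSol u R A) : BddBelow (Set.range u) :=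
  ⟨-2, by rintro _ ⟨t, rfl⟩; exact (abs_le.1 (h.abs_u_le t)).1⟩

/-! ### Attraction to `K₋` and the boundary orbits. -/

/-- A solution that enters `Σ₃ > 3/2` converges to `K₋`. -/
theorem tendsto_KMinus_of_lt (h : RedSol u R A) {t₀ : ℝ} (h₀ : 3 / 2 < u t₀) :
    Tendsto (fun t => hoPoint (u t) (R t) (A t)) atTop (𝓝 KMinus) := by
  -- The midpoint satisfies `c² < 3` even when `u t₀ = √3`. Thus `R` and `A` cannot both vanish at
  -- `u = c`, and `u'` is strictly positive there.
  set c := (3 / 2 + u t₀) / 2 with hc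
  have hc1 : 3 / 2 < c := by rw [hc]; linarith
  have hc2 : c ^ 2 < 3 := by nlinarith [h.u_sq_le t₀]
  have hge : ∀ t, t₀ ≤ t → c ≤ u t := fun t ht => by
    refine le_of_deriv_pos_of_eq h.du (by linarith) (fun s _ _ hs => ?_) t ht le_rfl
    have := h.con s
    rw [hs] at this ⊢
    nlinarith [mul_pos (sub_pos.2 hc1) (sub_pos.2 hc2),
      mul_nonneg (show 0 ≤ 9 - 2 * c by nlinarith) (sq_nonneg (R s))]
  have hmono : MonotoneOn u (Set.Ici t₀) := by
    refine monotoneOn_of_deriv_nonneg (convex_Ici t₀) h.continuous_u.continuousOn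
      (fun t _ => (h.du t).differentiableAt.differentiableWithinAt) fun t ht => ?_
    rw [interior_Ici] at ht
    rw [(h.du t).deriv]
    nlinarith [hge t (le_of_lt ht), sq_nonneg (R t), sq_nonneg (A t)]
  obtain ⟨L, hL⟩ : ∃ L, Tendsto u atTop (𝓝 L) := by
    have hm : Monotone fun t => u (max t t₀) := fun s t hst =>
      hmono (Set.mem_Ici.2 (le_max_right s t₀)) (Set.mem_Ici.2 (le_max_right t t₀))
        (max_le_max_right t₀ hst)
    refine ⟨_, (tendsto_atTop_ciSup hm (h.bddAbove_u.mono ?_)).congr' ?_⟩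
    · rintro _ ⟨t, rfl⟩
      exact ⟨_, rfl⟩
    · filter_upwards [eventually_ge_atTop t₀] with t ht
      rw [max_eq_left ht]
  have hd := h.tendsto_deriv_u_atTop hL
  have hR : Tendsto R atTop (𝓝 0) := by
    refine tendsto_of_tendsto_sq h.R_nonneg le_rfl ?_
    rw [zero_pow two_ne_zero]
    refine squeeze_zero' (Eventually.of_forall fun t => sq_nonneg _) ?_ hd
    filter_upwards [eventually_ge_atTop t₀] with t ht
    nlinarith [hge t ht, sq_nonneg (R t), sq_nonneg (A t)]
  have hA : Tendsto A atTop (𝓝 0) := by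
    refine tendsto_of_tendsto_sq h.A_nonneg le_rfl ?_
    rw [zero_pow two_ne_zero]
    refine squeeze_zero' (Eventually.of_forall fun t => sq_nonneg _) ?_
      (by simpa using hd.div_const (2 * c - 3))
    filter_upwards [eventually_ge_atTop t₀] with t ht
    rw [le_div_iff₀ (by linarith)]
    nlinarith [hge t ht, sq_nonneg (R t), sq_nonneg (A t)]
  have hu : Tendsto u atTop (𝓝 √3) := by
    have hL2 : L ^ 2 = 3 := by
      have h1 := ((hL.pow 2).div_const 3).add (hR.pow 2) |>.add (hA.pow 2)
      have h2 := tendsto_nhds_unique (h1.congr h.con) tendsto_const_nhds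
      linarith
    have hL0 : 0 ≤ L := by
      refine ge_of_tendsto hL ?_
      filter_upwards [eventually_ge_atTop t₀] with t ht
      linarith [hge t ht]
    rwa [← hL2, Real.sqrt_sq hL0]
  rw [KMinus_eq]
  exact tendsto_hoPoint hu hR hA

/-- On solutions with `R₁ > 0`, `Σ₃` increases beyond `3/2` after reaching it. -/
theorem three_halves_lt_of_le (h : RedSol u R A) (hR : ∀ t, 0 < R t) {t₀ t₁ : ℝ}
    (h₀ : 3 / 2 ≤ u t₀) (h₁ : t₀ < t₁) : 3 / 2 < u t₁ := by
  have hge : ∀ t, t₀ ≤ t → 3 / 2 ≤ u t := fun t ht => by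
    refine le_of_deriv_pos_of_eq h.du h₀ (fun s _ _ hs => ?_) t ht le_rfl
    rw [hs]
    nlinarith [hR s, pow_pos (hR s) 2]
  have hmono : StrictMonoOn u (Set.Ici t₀) := by
    refine strictMonoOn_of_deriv_pos (convex_Ici t₀) h.continuous_u.continuousOn fun t ht => ?_
    rw [interior_Ici] at ht
    rw [(h.du t).deriv]
    nlinarith [hge t (le_of_lt ht), pow_pos (hR t) 2, sq_nonneg (A t)]
  exact h₀.trans_lt (hmono Set.self_mem_Ici (Set.mem_Ici.2 h₁.le) h₁)

/-- A solution with `R₁ > 0` that reaches `Σ₃ ≥ 3/2` converges to `K₋`. -/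
theorem tendsto_KMinus_of_le (h : RedSol u R A) (hR : ∀ t, 0 < R t) {t₀ : ℝ} (h₀ : 3 / 2 ≤ u t₀) :
    Tendsto (fun t => hoPoint (u t) (R t) (A t)) atTop (𝓝 KMinus) :=
  h.tendsto_KMinus_of_lt (h.three_halves_lt_of_le hR h₀ (lt_add_one t₀))

/-- On the boundary part `A = 0`, every solution with `R₁ > 0` runs from `K₊` to `K₋`. -/
theorem tendsto_of_A_eq_zero (h : RedSol u R A) (hA : ∀ t, A t = 0) (hR : ∀ t, 0 < R t) :
    Tendsto (fun t => hoPoint (u t) (R t) (A t)) atBot (𝓝 KPlus) ∧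
      Tendsto (fun t => hoPoint (u t) (R t) (A t)) atTop (𝓝 KMinus) := by
  have hmono : Monotone u := by
    refine monotone_of_deriv_nonneg (fun t => (h.du t).differentiableAt) fun t => ?_
    rw [(h.du t).deriv, hA t]
    nlinarith [sq_nonneg (R t)]
  have hR2 : ∀ t, R t ^ 2 = 1 - u t ^ 2 / 3 := fun t => by
    have := h.con t
    rw [hA t] at this
    linarith
  have h3 : √3 ^ 2 = (3 : ℝ) := Real.sq_sqrt (by norm_num)
  have h30 : (0 : ℝ) < √3 := by positivity
  have hlim : ∀ {l : Filter ℝ} {L : ℝ}, l.NeBot → Tendsto u l (𝓝 L) →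
      Tendsto (fun t => 2 * A t ^ 2 * u t + 6 * R t ^ 2 - 3 * A t ^ 2) l (𝓝 0) → L ^ 2 = 3 := by
    intro l L _ hL hd
    have h1 := (((hL.pow 2).div_const 3).const_sub 1).const_mul 6
    have h2 := tendsto_nhds_unique h1 (hd.congr fun t => by rw [hA t, hR2 t]; ring)
    linarith
  have hA' : ∀ l : Filter ℝ, Tendsto A l (𝓝 0) := fun l => by
    simpa [funext hA] using tendsto_const_nhds
  have h0 : u 0 ^ 2 < 3 := by nlinarith [hR2 0, pow_pos (hR 0) 2]
  have h0' := abs_lt.1 (abs_lt_sqrt_of_sq_lt h0)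
  constructor
  · have hL := tendsto_atBot_ciInf hmono h.bddBelow_u
    set L := ⨅ t, u t
    have hL3 := hlim inferInstance hL (h.tendsto_deriv_u_atBot hL)
    have hL0 : L ≤ u 0 := ciInf_le h.bddBelow_u 0
    have : L = -√3 := by
      have : (L - √3) * (L + √3) = 0 := by linear_combination hL3 - h3
      rcases mul_eq_zero.1 this with h' | h' <;> linarith
    rw [this] at hL
    rw [KPlus_eq]
    exact h.tendsto_hoPoint_of_u_A hL (hA' _) le_rfl (by rw [neg_sq, h3]; norm_num)
  · have hL := tendsto_atTop_ciSup hmono h.bddAbove_u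
    set L := ⨆ t, u t
    have hL3 := hlim inferInstance hL (h.tendsto_deriv_u_atTop hL)
    have hL0 : u 0 ≤ L := le_ciSup h.bddAbove_u 0
    have : L = √3 := by
      have : (L - √3) * (L + √3) = 0 := by linear_combination hL3 - h3
      rcases mul_eq_zero.1 this with h' | h' <;> linarith
    rw [this] at hL
    rw [KMinus_eq]
    exact h.tendsto_hoPoint_of_u_A hL (hA' _) le_rfl (by rw [h3]; norm_num)

/-- On the boundary part `R₁ = 0`, the sign of `Σ₃ - 3/2` does not change. -/
theorem hasDerivAt_two_mul_u_sub_three (h : RedSol u R A) (hR : ∀ t, R t = 0) (t : ℝ) :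
    HasDerivAt (fun t => 2 * u t - 3) (2 * A t ^ 2 * (2 * u t - 3)) t := by
  convert! ((h.du t).const_mul 2).sub_const 3 using 1
  rw [hR t]
  ring

theorem lt_three_halves_of_R_eq_zero (h : RedSol u R A) (hR : ∀ t, R t = 0) {s : ℝ}
    (hs : u s < 3 / 2) (t : ℝ) : u t < 3 / 2 := by
  have := pos_of_hasDerivAt_mul (f := fun t => -(2 * u t - 3)) (g := fun t => 2 * A t ^ 2)
    (by have := h.continuous_A; fun_prop)
    (fun t => ((h.hasDerivAt_two_mul_u_sub_three hR t).neg).congr_deriv (by ring))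
    (s := s) (by linarith) t
  linarith

theorem three_halves_lt_of_R_eq_zero (h : RedSol u R A) (hR : ∀ t, R t = 0) {s : ℝ}
    (hs : 3 / 2 < u s) (t : ℝ) : 3 / 2 < u t := by
  have := pos_of_hasDerivAt_mul (by have := h.continuous_A; fun_prop)
    (h.hasDerivAt_two_mul_u_sub_three hR) (s := s) (by linarith) t
  linarith

/-- With `R = 0` the derivative is `(1 - u²/3)(2u - 3)`; its limit is zero, so `L` is a root of this
cubic. -/
theorem root_of_R_eq_zero {l : Filter ℝ} [l.NeBot] (h : RedSol u R A)
    (hR : ∀ t, R t = 0) {L : ℝ} (hL : Tendsto u l (𝓝 L))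
    (hd : Tendsto (fun t => 2 * A t ^ 2 * u t + 6 * R t ^ 2 - 3 * A t ^ 2) l (𝓝 0)) :
    L = 3 / 2 ∨ L = √3 ∨ L = -√3 := by
  have h1 := (((hL.pow 2).div_const 3).const_sub 1).mul ((hL.const_mul 2).sub_const 3)
  have h2 := tendsto_nhds_unique h1 (hd.congr fun t => by rw [h.deriv_u_eq, hR t]; ring)
  have h3 : √3 ^ 2 = (3 : ℝ) := Real.sq_sqrt (by norm_num)
  have h4 : (L - 3 / 2) * ((L - √3) * (L + √3)) = 0 := by
    linear_combination (-3 / 2) * h2 - (L - 3 / 2) * h3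
  rcases mul_eq_zero.1 h4 with h' | h'
  · exact Or.inl (by linarith)
  · rcases mul_eq_zero.1 h' with h' | h'
    · exact Or.inr (Or.inl (by linarith))
    · exact Or.inr (Or.inr (by linarith))

/-- On the boundary part `R₁ = 0`, solutions with `Σ₃ < 3/2` run from `PW⁰` to `K₊`. -/
theorem tendsto_of_R_eq_zero_of_lt (h : RedSol u R A) (hR : ∀ t, R t = 0) (hA : ∀ t, 0 < A t)
    (hu : u 0 < 3 / 2) : Tendsto (fun t => hoPoint (u t) (R t) (A t)) atBot (𝓝 PW0) ∧
      Tendsto (fun t => hoPoint (u t) (R t) (A t)) atTop (𝓝 KPlus) := by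
  have hlt := h.lt_three_halves_of_R_eq_zero hR hu
  have hanti : Antitone u := by
    refine antitone_of_deriv_nonpos (fun t => (h.du t).differentiableAt) fun t => ?_
    rw [(h.du t).deriv, hR t]
    nlinarith [hlt t, sq_nonneg (A t)]
  have h3 : √3 ^ 2 = (3 : ℝ) := Real.sq_sqrt (by norm_num)
  have h0 : u 0 ^ 2 < 3 := by
    have := h.con 0
    rw [hR 0] at this
    nlinarith [pow_pos (hA 0) 2]
  have h0' := abs_lt.1 (abs_lt_sqrt_of_sq_lt h0)
  have hR' : ∀ l : Filter ℝ, Tendsto R l (𝓝 0) := fun l => by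
    simpa [funext hR] using tendsto_const_nhds
  have h32 := three_halves_lt_sqrt_three
  constructor
  · have hL := tendsto_atBot_ciSup hanti h.bddAbove_u
    set L := ⨆ t, u t
    have hL0 : u 0 ≤ L := le_ciSup h.bddAbove_u 0
    have hL1 : L ≤ 3 / 2 := ciSup_le fun t => (hlt t).le
    have : L = 3 / 2 := by
      rcases h.root_of_R_eq_zero hR hL (h.tendsto_deriv_u_atBot hL) with h' | h' | h' <;> linarith
    rw [this] at hL
    rw [PW0_eq]
    exact h.tendsto_hoPoint_of_u_R hL (hR' _) (by norm_num) (by norm_num)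
  · have hL := tendsto_atTop_ciInf hanti h.bddBelow_u
    set L := ⨅ t, u t
    have hL0 : L ≤ u 0 := ciInf_le h.bddBelow_u 0
    have : L = -√3 := by
      rcases h.root_of_R_eq_zero hR hL (h.tendsto_deriv_u_atTop hL) with h' | h' | h' <;> linarith
    rw [this] at hL
    rw [KPlus_eq]
    exact h.tendsto_hoPoint_of_u_R hL (hR' _) le_rfl (by rw [neg_sq, h3]; norm_num)

/-- On the boundary part `R₁ = 0`, solutions with `Σ₃ > 3/2` and `A > 0` run from `PW⁰` to
`K₋`. -/
theorem tendsto_of_R_eq_zero_of_gt (h : RedSol u R A) (hR : ∀ t, R t = 0) (hA : ∀ t, 0 < A t)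
    (hu : 3 / 2 < u 0) : Tendsto (fun t => hoPoint (u t) (R t) (A t)) atBot (𝓝 PW0) ∧
      Tendsto (fun t => hoPoint (u t) (R t) (A t)) atTop (𝓝 KMinus) := by
  refine ⟨?_, h.tendsto_KMinus_of_lt hu⟩
  have hgt := h.three_halves_lt_of_R_eq_zero hR hu
  have hmono : Monotone u := by
    refine monotone_of_deriv_nonneg (fun t => (h.du t).differentiableAt) fun t => ?_
    rw [(h.du t).deriv, hR t]
    nlinarith [hgt t, sq_nonneg (A t)]
  have h0 : u 0 ^ 2 < 3 := by
    have := h.con 0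
    rw [hR 0] at this
    nlinarith [pow_pos (hA 0) 2]
  have h0' := abs_lt.1 (abs_lt_sqrt_of_sq_lt h0)
  have hR' : Tendsto R atBot (𝓝 0) := by
    simp [funext hR]
  have h32 := three_halves_lt_sqrt_three
  have hL := tendsto_atBot_ciInf hmono h.bddBelow_u
  set L := ⨅ t, u t
  have hL0 : L ≤ u 0 := ciInf_le h.bddBelow_u 0
  have hL1 : 3 / 2 ≤ L := le_ciInf fun t => (hgt t).le
  have : L = 3 / 2 := by
    rcases h.root_of_R_eq_zero hR hL (h.tendsto_deriv_u_atBot hL) with h' | h' | h' <;> linarith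
  rw [this] at hL
  rw [PW0_eq]
  exact h.tendsto_hoPoint_of_u_R hL hR' (by norm_num) (by norm_num)

/-! ### The monotone function and the past limit `RT`. -/

theorem nine_sub_pos (h : RedSol u R A) (t : ℝ) : 5 ≤ 9 - 2 * u t := by
  linarith [(abs_le.1 (h.abs_u_le t)).2]

theorem hasDerivAt_log_R (h : RedSol u R A) (hR : ∀ t, 0 < R t) (t : ℝ) :
    HasDerivAt (fun t => Real.log (R t)) (2 * A t ^ 2 - 2 * u t) t := by
  convert! (h.dR t).log (hR t).ne' using 1
  have := (hR t).ne'
  field_simp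

theorem hasDerivAt_log_A (h : RedSol u R A) (hA : ∀ t, 0 < A t) (t : ℝ) :
    HasDerivAt (fun t => Real.log (A t)) (2 * A t ^ 2 + u t - 2) t := by
  convert! (h.dA t).log (hA t).ne' using 1
  have := (hA t).ne'
  field_simp

/-- The logarithm of the monotone function on the interior of `HO`. -/
theorem hasDerivAt_lyapunov (h : RedSol u R A) (hR : ∀ t, 0 < R t) (hA : ∀ t, 0 < A t) (t : ℝ) :
    HasDerivAt (fun t => 5 * Real.log (R t) + 18 * Real.log (A t) - 23 * Real.log (9 - 2 * u t))
      (-12 * (3 * u t - 2) ^ 2 / (9 - 2 * u t)) t := by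
  have h9 := (show 0 < 9 - 2 * u t by linarith [h.nine_sub_pos t]).ne'
  refine ((((h.hasDerivAt_log_R hR t).const_mul 5).add
    ((h.hasDerivAt_log_A hA t).const_mul 18)).sub
    (((((h.du t).const_mul 2).const_sub 9).log h9).const_mul 23)).congr_deriv ?_
  -- Then `u' = 6 - 2u² - (9 - 2u)A²`. The terms in `A²` cancel since `5 + 18 = 23`, and the ratio
  -- `5 : 18`, that of `R²` to `A²` at `RT`, makes the remaining quadratic in `u` a perfect square.
  have h2 : R t ^ 2 = 1 - u t ^ 2 / 3 - A t ^ 2 := by linarith [h.con t]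
  rw [h2, eq_div_iff h9, sub_mul, mul_assoc 23, div_mul_cancel₀ _ h9]
  ring

theorem antitone_lyapunov (h : RedSol u R A) (hR : ∀ t, 0 < R t) (hA : ∀ t, 0 < A t) :
    Antitone fun t => 5 * Real.log (R t) + 18 * Real.log (A t) - 23 * Real.log (9 - 2 * u t) := by
  refine antitone_of_deriv_nonpos
    (fun t => (h.hasDerivAt_lyapunov hR hA t).differentiableAt) fun t => ?_
  rw [(h.hasDerivAt_lyapunov hR hA t).deriv]
  exact div_nonpos_of_nonpos_of_nonneg (by nlinarith [sq_nonneg (3 * u t - 2)])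
    (by linarith [h.nine_sub_pos t])

theorem exists_deriv_deriv_lyapunov (h : RedSol u R A) : ∃ w : ℝ → ℝ, (∀ t,
    HasDerivAt (fun t => -12 * (3 * u t - 2) ^ 2 / (9 - 2 * u t)) (w t) t) ∧
    ∃ C, ∀ t, |w t| ≤ C := by
  obtain ⟨C, hC⟩ := h.exists_abs_le (F := fun p =>
    (-12 * (2 * (3 * p.1 - 2) * (3 * (2 * p.2.2 ^ 2 * p.1 + 6 * p.2.1 ^ 2 - 3 * p.2.2 ^ 2))) *
      (9 - 2 * p.1) - -12 * (3 * p.1 - 2) ^ 2 *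
      -(2 * (2 * p.2.2 ^ 2 * p.1 + 6 * p.2.1 ^ 2 - 3 * p.2.2 ^ 2))) / (9 - 2 * p.1) ^ 2)
    (ContinuousOn.div (by fun_prop) (by fun_prop) fun p hp => by
      have := hp.1.2
      have : 0 < 9 - 2 * p.1 := by linarith
      positivity)
  refine ⟨_, fun t => ?_, C, hC⟩
  have h9 := (show 0 < 9 - 2 * u t by linarith [h.nine_sub_pos t]).ne'
  have h1 : HasDerivAt (fun t => (3 * u t - 2) ^ 2) _ t :=
    (((h.du t).const_mul 3).sub_const 2).pow 2
  convert! (h1.const_mul (-12)).div (((h.du t).const_mul 2).const_sub 9) h9 using 1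
  simp

theorem tendsto_u_of_tendsto_deriv_lyapunov (h : RedSol u R A) {l : Filter ℝ}
    (hd : Tendsto (fun t => -12 * (3 * u t - 2) ^ 2 / (9 - 2 * u t)) l (𝓝 0)) :
    Tendsto u l (𝓝 (2 / 3)) := by
  have h1 : Tendsto (fun t => (3 * u t - 2) ^ 2) l (𝓝 0) := by
    -- The factor `-2` suffices because `9 - 2u ≤ 13 < 24`.
    refine squeeze_zero (fun t => sq_nonneg _) (fun t => ?_)
      (by simpa only [mul_zero] using hd.const_mul (-2))
    have := h.nine_sub_pos t
    have := (abs_le.1 (h.abs_u_le t)).1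
    rw [← mul_div_assoc, le_div_iff₀ (by linarith)]
    nlinarith [sq_nonneg (3 * u t - 2)]
  have h2 : Tendsto (fun t => 3 * u t - 2) l (𝓝 0) := by
    refine (tendsto_zero_iff_abs_tendsto_zero _).2 ?_
    simpa [Real.sqrt_sq_eq_abs] using! h1.sqrt
  have h3 := (h2.add_const 2).div_const 3
  simpa using h3

/-- Eliminating `R²` gives `A² = (6 - 2u² - u')/(9 - 2u)`, which tends to `2/3`; the constraint then
fixes `R`. -/
theorem tendsto_RT_of_tendsto (h : RedSol u R A) {l : Filter ℝ} (hu : Tendsto u l (𝓝 (2 / 3)))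
    (hd : Tendsto (fun t => 2 * A t ^ 2 * u t + 6 * R t ^ 2 - 3 * A t ^ 2) l (𝓝 0)) :
    Tendsto (fun t => hoPoint (u t) (R t) (A t)) l (𝓝 RT) := by
  have hA : Tendsto A l (𝓝 √(2 / 3)) := by
    refine tendsto_of_tendsto_sq h.A_nonneg (Real.sqrt_nonneg _) ?_
    have h1 := (((hu.pow 2).const_mul 2).const_sub 6 |>.sub hd).div
      ((hu.const_mul 2).const_sub 9) (by norm_num)
    rw [Real.sq_sqrt (by norm_num)]
    convert! h1 using 2 with t
    · have := h.nine_sub_pos t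
      rw [eq_comm, Pi.div_apply, div_eq_iff (by linarith)]
      linear_combination -6 * h.con t
    · norm_num
  rw [RT_eq]
  refine h.tendsto_hoPoint_of_u_A hu hA (by positivity) ?_
  rw [div_pow √5, mul_pow, Real.sq_sqrt (by norm_num), Real.sq_sqrt (by norm_num),
    Real.sq_sqrt (by norm_num)]
  norm_num

/-- Interior solutions come from `RT`. -/
theorem tendsto_RT_atBot (h : RedSol u R A) (hR : ∀ t, 0 < R t) (hA : ∀ t, 0 < A t) :
    Tendsto (fun t => hoPoint (u t) (R t) (A t)) atBot (𝓝 RT) := by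
  have hW := h.hasDerivAt_lyapunov hR hA
  have hbdd : BddAbove (Set.range fun t => 5 * Real.log (R t) + 18 * Real.log (A t) -
      23 * Real.log (9 - 2 * u t)) := by
    refine ⟨0, ?_⟩
    rintro _ ⟨t, rfl⟩
    have h1 := Real.log_nonpos (hR t).le (abs_le.1 (h.abs_R_le t)).2
    have h2 := Real.log_nonpos (hA t).le (abs_le.1 (h.abs_A_le t)).2
    have h3 := Real.log_nonneg (show 1 ≤ 9 - 2 * u t by linarith [h.nine_sub_pos t])
    simp only
    linarith
  have hlim := tendsto_atBot_ciSup (h.antitone_lyapunov hR hA) hbdd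
  obtain ⟨w, hw, C, hC⟩ := h.exists_deriv_deriv_lyapunov
  have hu := h.tendsto_u_of_tendsto_deriv_lyapunov (tendsto_deriv_atBot_of_bounded hW hw hC hlim)
  exact h.tendsto_RT_of_tendsto hu (h.tendsto_deriv_u_atBot hu)

/-- The monotone function is continuous at `RT` and has the same limit at both ends, so it is
constant. Its derivative vanishes, hence `u = 2/3` and `u' = 0` at all times. -/
theorem eq_RT_of_tendsto_atTop (h : RedSol u R A) (hR : ∀ t, 0 < R t) (hA : ∀ t, 0 < A t)
    (hT : Tendsto (fun t => hoPoint (u t) (R t) (A t)) atTop (𝓝 RT)) (t : ℝ) :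
    hoPoint (u t) (R t) (A t) = RT := by
  have hcont : ContinuousAt (fun p : State =>
      5 * Real.log (p 3) + 18 * Real.log (p 6) - 23 * Real.log (9 - 2 * p 2)) RT := by
    have h1 : RT 3 ≠ 0 := (show 0 < √5 / (3 * √3) by positivity).ne'
    have h2 : RT 6 ≠ 0 := (show 0 < √(2 / 3 : ℝ) by positivity).ne'
    have h3 : 9 - 2 * RT 2 ≠ 0 := (show (0 : ℝ) < 9 - 2 * (2 / 3) by norm_num).ne'
    have h4 : ∀ i, ContinuousAt (fun p : State => p i) RT := fun i =>
      (continuous_apply i).continuousAt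
    exact (((h4 3).log h1).const_mul 5 |>.add (((h4 6).log h2).const_mul 18)).sub
      ((((h4 2).const_mul 2).const_sub 9 |>.log h3).const_mul 23)
  have h1 := hcont.tendsto.comp hT
  have h2 := hcont.tendsto.comp (h.tendsto_RT_atBot hR hA)
  have hanti := h.antitone_lyapunov hR hA
  have hconst : ∀ s, 5 * Real.log (R s) + 18 * Real.log (A s) - 23 * Real.log (9 - 2 * u s) =
      5 * Real.log (RT 3) + 18 * Real.log (RT 6) - 23 * Real.log (9 - 2 * RT 2) := fun s =>
    le_antisymm (hanti.ge_of_tendsto h2 s) (hanti.le_of_tendsto h1 s)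
  have hu : ∀ s, u s = 2 / 3 := fun s => by
    have h3 := h.hasDerivAt_lyapunov hR hA s
    rw [funext hconst] at h3
    have h4 := h3.unique (hasDerivAt_const s _)
    have h5 := h.nine_sub_pos s
    rw [div_eq_zero_iff] at h4
    rcases h4 with h4 | h4
    · have : (3 * u s - 2) ^ 2 = 0 := by linarith
      linarith [pow_eq_zero_iff two_ne_zero |>.1 this]
    · linarith
  have hd : ∀ s, 2 * A s ^ 2 * u s + 6 * R s ^ 2 - 3 * A s ^ 2 = 0 := fun s => by
    have h3 := h.du s
    rw [funext hu] at h3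
    have := h3.unique (hasDerivAt_const s _)
    rw [← this, hu s]
  -- Along the filter `pure t` the convergence lemma becomes an identity at time `t`.
  have h5 : Tendsto (fun t => hoPoint (u t) (R t) (A t)) (pure t) (𝓝 RT) :=
    h.tendsto_RT_of_tendsto (by simp [funext hu]) (by simp [funext hd])
  exact tendsto_nhds_unique (tendsto_pure_nhds _ t) h5

/-- Interior solutions other than `RT` approach the boundary. -/
theorem tendsto_R_mul_A (h : RedSol u R A) (hR : ∀ t, 0 < R t) (hA : ∀ t, 0 < A t)
    (hne : ∃ t, hoPoint (u t) (R t) (A t) ≠ RT) : Tendsto (fun t => R t * A t) atTop (𝓝 0) := by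
  rcases tendsto_atTop_of_antitone (h.antitone_lyapunov hR hA) with hW | ⟨L, hL⟩
  · have h1 : Tendsto (fun t => Real.log (R t * A t)) atTop atBot := by
      -- Since `log R ≤ 0` and `9 - 2u ≤ 13`, `18 log (RA) ≤ W + 23 log 13`.
      refine tendsto_atBot_mono (fun t => ?_)
        ((tendsto_atBot_add_const_right _ (23 * Real.log 13) hW).const_mul_atBot
          (show (0 : ℝ) < 1 / 18 by norm_num))
      have h2 := Real.log_nonpos (hR t).le (abs_le.1 (h.abs_R_le t)).2
      have h3 := Real.log_le_log (by linarith [h.nine_sub_pos t] : 0 < 9 - 2 * u t)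
        (by linarith [(abs_le.1 (h.abs_u_le t)).1] : 9 - 2 * u t ≤ 13)
      rw [Real.log_mul (hR t).ne' (hA t).ne']
      linarith
    refine (Real.tendsto_exp_atBot.comp h1).congr fun t => ?_
    exact Real.exp_log (mul_pos (hR t) (hA t))
  · obtain ⟨w, hw, C, hC⟩ := h.exists_deriv_deriv_lyapunov
    have hu := h.tendsto_u_of_tendsto_deriv_lyapunov
      (tendsto_deriv_atTop_of_bounded (h.hasDerivAt_lyapunov hR hA) hw hC hL)
    have hT := h.tendsto_RT_of_tendsto hu (h.tendsto_deriv_u_atTop hu)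
    obtain ⟨t, ht⟩ := hne
    exact absurd (h.eq_RT_of_tendsto_atTop hR hA hT t) ht

/-! ### Interior solutions confined to `Σ₃ < 3/2`. -/

theorem hasDerivAt_log_R_sub_log_A (h : RedSol u R A) (hR : ∀ t, 0 < R t) (hA : ∀ t, 0 < A t)
    (t : ℝ) : HasDerivAt (fun t => Real.log (R t) - Real.log (A t)) (2 - 3 * u t) t :=
  ((h.hasDerivAt_log_R hR t).sub (h.hasDerivAt_log_A hA t)).congr_deriv (by ring)

/-- If `R₁ A` is small when `Σ₃` increases through `2/3`, then `Σ₃` goes on to reach `3/2`. -/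
theorem deriv_u_neg_of_R_mul_A_lt (h : RedSol u R A) (hR : ∀ t, 0 < R t) (hA : ∀ t, 0 < A t)
    (hu : ∀ t, u t < 3 / 2) {t₀ : ℝ} (h₀ : u t₀ = 2 / 3)
    (hRA : R t₀ * A t₀ < 5 / 27 * Real.exp (-(25 / 6))) :
    2 * A t₀ ^ 2 * u t₀ + 6 * R t₀ ^ 2 - 3 * A t₀ ^ 2 < 0 := by
  by_contra! hge
  have hc0 := h.con t₀
  rw [h₀] at hge hc0
  -- At `u = 2/3`, `u' ≥ 0` means `R² ≥ (5/18)A²`; with `R² + A² = 23/27` this gives `R² ≥ 5/27`, so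
  -- smallness of `RA` makes `R/A` exceed `exp (25/6)`. As `2 - 3u ≥ -5/2`, this keeps `A ≤ R` for
  -- time `5/3`.
  have hlog : Real.log (A t₀) + 25 / 6 ≤ Real.log (R t₀) := by
    rw [← Real.log_exp (25 / 6), ← Real.log_mul (hA t₀).ne' (Real.exp_pos _).ne']
    refine Real.log_le_log (mul_pos (hA t₀) (Real.exp_pos _)) ?_
    have h1 : R t₀ * (A t₀ * Real.exp (25 / 6)) < 5 / 27 := by
      calc R t₀ * (A t₀ * Real.exp (25 / 6)) = R t₀ * A t₀ * Real.exp (25 / 6) := by ring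
        _ < 5 / 27 * Real.exp (-(25 / 6)) * Real.exp (25 / 6) := by
          gcongr
        _ = 5 / 27 := by rw [mul_assoc, ← Real.exp_add, neg_add_cancel, Real.exp_zero, mul_one]
    have h2 : R t₀ * (A t₀ * Real.exp (25 / 6)) < R t₀ * R t₀ := by nlinarith
    exact (lt_of_mul_lt_mul_left h2 (hR t₀).le).le
  have hAR : ∀ t, t₀ ≤ t → t ≤ t₀ + 5 / 3 → A t ≤ R t := fun t h1 h2 => by
    have h3 := add_mul_le_of_le_deriv (c := -(5 / 2)) (h.hasDerivAt_log_R_sub_log_A hR hA) h1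
      fun s _ _ => by linarith [hu s]
    refine (Real.log_le_log_iff (hA t) (hR t)).1 ?_
    linarith
  have hAR2 : ∀ t, t₀ ≤ t → t ≤ t₀ + 5 / 3 → A t ^ 2 ≤ R t ^ 2 := fun t h1 h2 =>
    pow_le_pow_left₀ (hA t).le (hAR t h1 h2) 2
  have hge' := le_of_deriv_pos_of_eq (b := t₀ + 5 / 3) h.du h₀.ge fun t h1 h2 h3 => by
    rw [h3]
    nlinarith [hAR2 t h1 h2.le, pow_pos (hR t) 2]
  -- Growth at rate `1/2` for time `5/3` is `5/6 = 3/2 - 2/3`, which contradicts `u < 3/2`.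
  have := add_mul_le_of_le_deriv (a := t₀) (b := t₀ + 5 / 3) (c := 1 / 2) h.du (by linarith)
    fun t h1 h2 => by
      have e1 := hAR2 t h1 h2.le
      have e2 := hge' t h1 h2.le
      have e3 := hu t
      have e4 := h.con t
      have e5 : u t ^ 2 ≤ 9 / 4 := by nlinarith
      nlinarith [mul_nonneg (sub_nonneg.2 e2) (sq_nonneg (A t))]
  linarith [hu (t₀ + 5 / 3)]

/-- An interior solution near the boundary does not stay in `Σ₃ ≤ 2/3`. -/
theorem exists_two_thirds_lt (h : RedSol u R A) (hR : ∀ t, 0 < R t) (hA : ∀ t, 0 < A t)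
    (hRA : Tendsto (fun t => R t * A t) atTop (𝓝 0)) (T : ℝ) : ∃ t, T ≤ t ∧ 2 / 3 < u t := by
  by_contra! hu
  have hRk : ∀ t, T ≤ t → Real.exp (Real.log (R T) - Real.log (A T)) * A t ≤ R t := fun t ht => by
    have h1 := add_mul_le_of_le_deriv (c := 0) (h.hasDerivAt_log_R_sub_log_A hR hA) ht
      fun s hs _ => by linarith [hu s hs]
    rw [← Real.exp_log (hA t), ← Real.exp_add]
    nth_rw 1 [← Real.exp_log (hR t)]
    rw [Real.exp_le_exp]
    linarith
  set k := Real.exp (Real.log (R T) - Real.log (A T))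
  have hk : 0 < k := Real.exp_pos _
  obtain ⟨T₂, hT₂, hA2⟩ : ∃ T₂, T ≤ T₂ ∧ ∀ t, T₂ ≤ t → A t ^ 2 ≤ 1 / 100 := by
    obtain ⟨T', hT'⟩ := eventually_atTop.1
      (hRA.eventually (ge_mem_nhds (show (0 : ℝ) < k / 100 by positivity)))
    refine ⟨max T T', le_max_left _ _, fun t ht => ?_⟩
    have h1 := hT' t ((le_max_right _ _).trans ht)
    have h2 := mul_le_mul_of_nonneg_right (hRk t ((le_max_left _ _).trans ht)) (hA t).le
    have h3 : k * A t ^ 2 ≤ k * (1 / 100) := by linarith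
    exact le_of_mul_le_mul_left h3 hk
  -- While `u < -1`, `log R` grows at rate at least `2`, yet it is never positive.
  obtain ⟨T₃, hT₃, hu3⟩ : ∃ T₃, T₂ ≤ T₃ ∧ -1 ≤ u T₃ := by
    by_contra! hlt
    have h0 := Real.log_nonpos (hR T₂).le (abs_le.1 (h.abs_R_le T₂)).2
    have h1 := add_mul_le_of_le_deriv (a := T₂) (b := T₂ + (1 - Real.log (R T₂))) (c := 2)
      (h.hasDerivAt_log_R hR) (by linarith) fun s hs _ => by
        linarith [hlt s hs, sq_nonneg (A s)]
    have h2 := Real.log_nonpos (hR (T₂ + (1 - Real.log (R T₂)))).le (abs_le.1 (h.abs_R_le _)).2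
    linarith
  -- Here `u' = 6 - 2u² - (9 - 2u)A²` with `u² ≤ 1` and `A² ≤ 1/100`; at rate `1`, `u` gets from
  -- `-1` past `2/3` within time `2`.
  have hd : ∀ t, T₃ ≤ t → -1 ≤ u t →
      1 ≤ 2 * A t ^ 2 * u t + 6 * R t ^ 2 - 3 * A t ^ 2 := fun t ht ht' => by
    have e1 := h.con t
    have e2 := hA2 t (hT₃.trans ht)
    have e3 := hu t (hT₂.trans (hT₃.trans ht))
    have e4 : u t ^ 2 ≤ 1 := by nlinarith
    nlinarith [mul_nonneg (sub_nonneg.2 e2) (show 0 ≤ 9 - 2 * u t by linarith)]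
  have hge := le_of_deriv_pos_of_eq (b := T₃ + 2) h.du hu3 fun t h1 h2 h3 =>
    lt_of_lt_of_le one_pos (hd t h1 h3.ge)
  have := add_mul_le_of_le_deriv (a := T₃) (b := T₃ + 2) h.du (by linarith)
    fun t h1 h2 => hd t h1 (hge t h1 h2.le)
  linarith [hu (T₃ + 2) (by linarith)]

/-- Once `R²` is small, `u' = -(3 - 2u)A² + 6R²` is at most `-ε/8` wherever `u ≤ 3/2 - ε`; so a late
dip below that level would carry `u` down past `2/3`. -/
theorem tendsto_three_halves (h : RedSol u R A) {T : ℝ} (hT : ∀ t, T ≤ t → 2 / 3 < u t)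
    (hu : ∀ t, u t < 3 / 2) (hR : Tendsto (fun t => R t ^ 2) atTop (𝓝 0)) :
    Tendsto u atTop (𝓝 (3 / 2)) := by
  rw [Metric.tendsto_nhds]
  intro ε hε
  obtain ⟨T', hT'⟩ := eventually_atTop.1
    ((hR.eventually (ge_mem_nhds (show (0 : ℝ) < ε / 48 by positivity))).and
      (hR.eventually (ge_mem_nhds (show (0 : ℝ) < 1 / 8 by positivity))))
  have hd : ∀ t, max T T' ≤ t → u t ≤ 3 / 2 - ε →
      2 * A t ^ 2 * u t + 6 * R t ^ 2 - 3 * A t ^ 2 ≤ -(ε / 8) := fun t ht ht' => by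
    have e1 := h.con t
    obtain ⟨e2, e3⟩ := hT' t ((le_max_right _ _).trans ht)
    have e4 := hT t ((le_max_left _ _).trans ht)
    have e5 : u t ^ 2 ≤ 9 / 4 := by nlinarith [hu t]
    have e6 : 1 / 8 ≤ A t ^ 2 := by linarith
    nlinarith [mul_nonneg (sub_nonneg.2 e6) (show 0 ≤ 3 - 2 * u t by linarith)]
  filter_upwards [eventually_ge_atTop (max T T')] with t ht
  rw [Real.dist_eq, abs_lt]
  refine ⟨?_, by linarith [hu t]⟩
  by_contra! hlt
  have hle := le_of_deriv_neg_of_eq (b := t + 16 / ε) h.du (show u t ≤ 3 / 2 - ε by linarith)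
    fun s h1 h2 h3 => lt_of_le_of_lt (hd s (ht.trans h1) h3.le) (by linarith)
  have h16 : 0 < 16 / ε := by positivity
  have := add_mul_le_of_le_deriv (a := t) (b := t + 16 / ε) (c := ε / 8) (fun s => (h.du s).neg)
    (by linarith) fun s h1 h2 => by linarith [hd s (ht.trans h1) (hle s h1 h2.le)]
  have h2 : ε / 8 * (t + 16 / ε - t) = 2 := by field_simp; norm_num
  rw [h2] at this
  simp only [Pi.neg_apply] at this
  linarith [hT (t + 16 / ε) ((le_max_left _ _).trans (ht.trans (by linarith))), hu t]

/-- An interior solution other than `RT` that stays in `Σ₃ < 3/2` converges to `PW⁰`. -/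
theorem tendsto_PW0 (h : RedSol u R A) (hR : ∀ t, 0 < R t) (hA : ∀ t, 0 < A t)
    (hne : ∃ t, hoPoint (u t) (R t) (A t) ≠ RT) (hu : ∀ t, u t < 3 / 2) :
    Tendsto (fun t => hoPoint (u t) (R t) (A t)) atTop (𝓝 PW0) := by
  have hRA := h.tendsto_R_mul_A hR hA hne
  obtain ⟨T₁, hT₁⟩ := eventually_atTop.1 (hRA.eventually
    (gt_mem_nhds (show (0 : ℝ) < 5 / 27 * Real.exp (-(25 / 6)) by positivity)))
  have hgt : ∀ t, T₁ ≤ t → 2 / 3 < u t := by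
    -- Late crossings of `2/3` go downwards only, so a single late value `u ≤ 2/3` would persist
    -- forever.
    by_contra! hle
    obtain ⟨t, ht, htu⟩ := hle
    obtain ⟨s, hs, hsu⟩ := h.exists_two_thirds_lt hR hA hRA t
    have := le_of_deriv_neg_of_eq h.du htu (fun τ h1 _ h3 =>
      h.deriv_u_neg_of_R_mul_A_lt hR hA hu h3 (hT₁ τ (ht.trans h1))) s hs le_rfl
    linarith
  have hRk : ∀ t, T₁ ≤ t → R t ≤ Real.exp (Real.log (R T₁) - Real.log (A T₁)) * A t :=
    fun t ht => by
      have h1 := add_mul_le_of_le_deriv (c := 0)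
        (fun s => (h.hasDerivAt_log_R_sub_log_A hR hA s).neg) ht
        fun s hs _ => by linarith [hgt s hs]
      rw [← Real.exp_log (hA t), ← Real.exp_add]
      nth_rw 1 [← Real.exp_log (hR t)]
      rw [Real.exp_le_exp]
      simp only [Pi.neg_apply] at h1
      linarith
  have hR2 : Tendsto (fun t => R t ^ 2) atTop (𝓝 0) := by
    refine squeeze_zero' (Eventually.of_forall fun t => sq_nonneg _) ?_
      (by simpa only [mul_zero] using hRA.const_mul (Real.exp (Real.log (R T₁) - Real.log (A T₁))))
    filter_upwards [eventually_ge_atTop T₁] with t ht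
    nlinarith [mul_le_mul_of_nonneg_right (hRk t ht) (hR t).le]
  rw [PW0_eq]
  exact h.tendsto_hoPoint_of_u_R (h.tendsto_three_halves hgt hu hR2)
    (tendsto_of_tendsto_sq h.R_nonneg le_rfl (by simpa using hR2)) (by norm_num) (by norm_num)

end RedSol

/-! ### Uniqueness of the interior orbit that ends at `PW⁰`. -/

theorem exists_ge_eq_of_tendsto {f : ℝ → ℝ} (hf : Continuous f) {T c L : ℝ} (hT : c ≤ f T)
    (hL : Tendsto f atTop (𝓝 L)) (hc : L < c) : ∃ t, T ≤ t ∧ f t = c := by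
  obtain ⟨s, hs1, hs2⟩ := ((eventually_ge_atTop T).and (hL.eventually (gt_mem_nhds hc))).exists
  obtain ⟨t, ht, htc⟩ := intermediate_value_Icc' hs1 hf.continuousOn ⟨hs2.le, hT⟩
  exact ⟨t, ht.1, htc⟩

/-- As a function of `log a`, the square `a²` has slope `2a² ≤ 2η`. The bound comes from `log x ≤ x
- 1` at `x = b²/a²`. -/
theorem abs_sq_sub_sq_le_log {a b η : ℝ} (ha : 0 < a) (hb : 0 < b) (haη : a ^ 2 ≤ η)
    (hbη : b ^ 2 ≤ η) : |a ^ 2 - b ^ 2| ≤ 2 * η * |Real.log a - Real.log b| := by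
  wlog hab : b ≤ a generalizing a b
  · rw [abs_sub_comm, abs_sub_comm (Real.log a)]
    exact this hb ha hbη haη (le_of_not_ge hab)
  have h1 : b ^ 2 ≤ a ^ 2 := pow_le_pow_left₀ hb.le hab 2
  have h2 : Real.log b ≤ Real.log a := Real.log_le_log hb hab
  rw [abs_of_nonneg (by linarith), abs_of_nonneg (by linarith)]
  have h3 := Real.log_le_sub_one_of_pos (show 0 < b ^ 2 / a ^ 2 by positivity)
  rw [Real.log_div (by positivity) (by positivity), Real.log_pow, Real.log_pow, div_sub_one
    (by positivity), le_div_iff₀ (by positivity)] at h3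
  push_cast at h3
  nlinarith [mul_le_mul_of_nonneg_right haη (sub_nonneg.2 h2)]

/-- The quadratic form that expresses the expansion of a cone along the stable manifold of
`PW⁰`. -/
theorem cone_form_nonneg {α β γ ρ d e : ℝ} (hα : 9 / 20 ≤ α) (hβ0 : 0 ≤ β) (hβ : β ≤ 7)
    (hγ0 : 0 ≤ γ) (hγ : γ ≤ 41 / 10) (hρ : |ρ| ≤ 2 * (1 / 10000) * |e|) :
    0 ≤ (2 * α - 1 / 2) * d ^ 2 + 2 * β * (d * ρ) + 1 / 200 * γ * (e * d) + 1 / 100 * (e * ρ) +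
      1 / 800 * e ^ 2 := by
  have hD := abs_nonneg d
  have hE := abs_nonneg e
  have h1 : -(2 * (1 / 10000) * (|d| * |e|)) ≤ d * ρ := by
    have := neg_abs_le (d * ρ)
    rw [abs_mul] at this
    nlinarith [mul_le_mul_of_nonneg_left hρ hD]
  have h2 : -(|d| * |e|) ≤ e * d := by
    have := neg_abs_le (e * d)
    rw [abs_mul] at this
    linarith
  have h3 : -(2 * (1 / 10000) * |e| ^ 2) ≤ e * ρ := by
    have := neg_abs_le (e * ρ)
    rw [abs_mul] at this
    nlinarith [mul_le_mul_of_nonneg_left hρ hE]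
  have hDE : 0 ≤ |d| * |e| := mul_nonneg hD hE
  have h4 : -(28 / 10000 * (|d| * |e|)) ≤ 2 * β * (d * ρ) := by
    nlinarith [mul_le_mul_of_nonneg_left h1 hβ0, mul_le_mul_of_nonneg_right hβ hDE]
  have h5 : -(41 / 2000 * (|d| * |e|)) ≤ 1 / 200 * γ * (e * d) := by
    nlinarith [mul_le_mul_of_nonneg_left h2 hγ0, mul_le_mul_of_nonneg_right hγ hDE]
  have h6 : 2 / 5 * |d| ^ 2 ≤ (2 * α - 1 / 2) * d ^ 2 := by
    rw [sq_abs]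
    nlinarith [sq_nonneg d]
  rw [← sq_abs e]
  nlinarith [sq_nonneg (|d| - 1 / 20 * |e|), sq_nonneg |e|, sq_nonneg |d|]

namespace RedSol

/-- Two solutions that remain close to `PW⁰` and start with the same `R₁` start at the same
point. -/
theorem u_eq_of_R_eq {u₁ R₁ A₁ u₂ R₂ A₂ : ℝ → ℝ} (h₁ : RedSol u₁ R₁ A₁) (h₂ : RedSol u₂ R₂ A₂)
    (hR₁ : ∀ t, 0 < R₁ t) (hR₂ : ∀ t, 0 < R₂ t)
    (hu₁ : ∀ t, 0 ≤ t → |u₁ t - 3 / 2| ≤ 1 / 100) (hu₂ : ∀ t, 0 ≤ t → |u₂ t - 3 / 2| ≤ 1 / 100)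
    (hr₁ : ∀ t, 0 ≤ t → R₁ t ^ 2 ≤ 1 / 10000) (hr₂ : ∀ t, 0 ≤ t → R₂ t ^ 2 ≤ 1 / 10000)
    (hL₁ : Tendsto u₁ atTop (𝓝 (3 / 2))) (hL₂ : Tendsto u₂ atTop (𝓝 (3 / 2)))
    (h0 : R₁ 0 = R₂ 0) : u₁ 0 = u₂ 0 := by
  have hd : ∀ t, HasDerivAt (fun t => u₁ t - u₂ t)
      ((u₁ t - u₂ t) * (2 - 2 / 3 * (u₁ t ^ 2 + u₁ t * u₂ t + u₂ t ^ 2) + (u₁ t + u₂ t) -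
        2 * R₁ t ^ 2) + (R₁ t ^ 2 - R₂ t ^ 2) * (9 - 2 * u₂ t)) t := fun t => by
    refine ((h₁.du t).sub (h₂.du t)).congr_deriv ?_
    rw [h₁.deriv_u_eq, h₂.deriv_u_eq]
    ring
  have he : ∀ t, HasDerivAt (fun t => Real.log (R₁ t) - Real.log (R₂ t))
      (-((2 / 3 * (u₁ t + u₂ t) + 2) * (u₁ t - u₂ t) + 2 * (R₁ t ^ 2 - R₂ t ^ 2))) t :=
    fun t => by
      refine ((h₁.hasDerivAt_log_R hR₁ t).sub (h₂.hasDerivAt_log_R hR₂ t)).congr_deriv ?_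
      linear_combination 2 * h₁.con t - 2 * h₂.con t
  set d : ℝ → ℝ := fun t => u₁ t - u₂ t with hd_def
  -- At `PW⁰` the eigenvalues are `1/2` along `u` and `-5/2` along `R`. In logarithms the common
  -- contraction of `R` cancels, so `e` is driven by `d` and a small error only.
  set e : ℝ → ℝ := fun t => Real.log (R₁ t) - Real.log (R₂ t) with he_def
  -- The goal is that `(d² - e²/400) exp (-t/2)` is nondecreasing; the weight contributes the term
  -- `e²/800` that absorbs the cross terms in `cone_form_nonneg`.
  have hexp : ∀ t, HasDerivAt (fun t : ℝ => Real.exp (-(1 / 2 * t)))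
      (Real.exp (-(1 / 2 * t)) * -(1 / 2 * 1)) t := fun t =>
    ((hasDerivAt_id t).const_mul (1 / 2)).neg.exp
  have hd2 : ∀ t, HasDerivAt (fun t => d t ^ 2) _ t := fun t => (hd t).pow 2
  have he2 : ∀ t, HasDerivAt (fun t => e t ^ 2) _ t := fun t => (he t).pow 2
  have hV := fun t => ((hd2 t).sub ((he2 t).const_mul (1 / 400))).mul (hexp t)
  have hge : ∀ t, 0 ≤ t → d 0 ^ 2 ≤ d t ^ 2 := fun t ht => by
    have h1 := add_mul_le_of_le_deriv (c := 0) hV ht fun s hs _ => by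
      obtain ⟨a1, a2⟩ := abs_le.1 (hu₁ s hs)
      obtain ⟨b1, b2⟩ := abs_le.1 (hu₂ s hs)
      have hform := cone_form_nonneg (d := d s) (e := e s)
        (α := 2 - 2 / 3 * (u₁ s ^ 2 + u₁ s * u₂ s + u₂ s ^ 2) + (u₁ s + u₂ s) - 2 * R₁ s ^ 2)
        (β := 9 - 2 * u₂ s) (γ := 2 / 3 * (u₁ s + u₂ s) + 2)
        (by nlinarith [hr₁ s hs]) (by linarith) (by linarith) (by linarith) (by linarith)
        (abs_sq_sub_sq_le_log (hR₁ s) (hR₂ s) (hr₁ s hs) (hr₂ s hs))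
      have := mul_nonneg hform (Real.exp_pos (-(1 / 2 * s))).le
      refine this.trans (le_of_eq ?_)
      simp only [Pi.sub_apply]
      push_cast
      ring
    have he0 : e 0 = 0 := by simp [he_def, h0]
    simp only [Pi.mul_apply, Pi.sub_apply, he0] at h1
    norm_num at h1
    have h2 : Real.exp (-(1 / 2 * t)) ≤ 1 := Real.exp_le_one_iff.2 (by linarith)
    have h3 := Real.exp_pos (-(1 / 2 * t))
    nlinarith [sq_nonneg (e t), sq_nonneg (d t), mul_nonneg h3.le (sq_nonneg (e t))]
  have hlim : Tendsto (fun t => d t ^ 2) atTop (𝓝 0) := by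
    simpa using (hL₁.sub hL₂).pow 2
  have h2 : d 0 ^ 2 ≤ 0 := by
    refine ge_of_tendsto hlim ?_
    filter_upwards [eventually_ge_atTop 0] with t ht using hge t ht
  have h3 : d 0 = 0 := pow_eq_zero_iff two_ne_zero |>.1 (le_antisymm h2 (sq_nonneg _))
  exact sub_eq_zero.1 h3

/-- Two solutions with `R₁ > 0` that converge to `PW⁰` have a point in common. -/
theorem exists_eq_of_tendsto_PW0 {u₁ R₁ A₁ u₂ R₂ A₂ : ℝ → ℝ} (h₁ : RedSol u₁ R₁ A₁)
    (h₂ : RedSol u₂ R₂ A₂) (hR₁ : ∀ t, 0 < R₁ t) (hR₂ : ∀ t, 0 < R₂ t)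
    (hu₁ : Tendsto u₁ atTop (𝓝 (3 / 2))) (hu₂ : Tendsto u₂ atTop (𝓝 (3 / 2)))
    (hr₁ : Tendsto R₁ atTop (𝓝 0)) (hr₂ : Tendsto R₂ atTop (𝓝 0)) :
    ∃ t₁ t₂, u₁ t₁ = u₂ t₂ ∧ R₁ t₁ = R₂ t₂ := by
  have key : ∀ {u R : ℝ → ℝ}, Tendsto u atTop (𝓝 (3 / 2)) → Tendsto R atTop (𝓝 0) →
      ∃ T, ∀ t, T ≤ t → |u t - 3 / 2| ≤ 1 / 100 ∧ R t ^ 2 ≤ 1 / 10000 := fun {u R} hu hr => by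
    have hr2 : Tendsto (fun t => R t ^ 2) atTop (𝓝 0) := by simpa using hr.pow 2
    obtain ⟨T, hT⟩ := eventually_atTop.1 ((Metric.tendsto_nhds.1 hu (1 / 100) (by norm_num)).and
      (hr2.eventually (ge_mem_nhds (show (0 : ℝ) < 1 / 10000 by norm_num))))
    exact ⟨T, fun t ht => ⟨(hT t ht).1.le, (hT t ht).2⟩⟩
  obtain ⟨T₁, hT₁⟩ := key hu₁ hr₁
  obtain ⟨T₂, hT₂⟩ := key hu₂ hr₂
  -- Both `R₁` and `R₂` tend to zero, so each takes this common value later; time translation puts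
  -- both passages at time `0`.
  have hmin : 0 < min (R₁ T₁) (R₂ T₂) := lt_min (hR₁ _) (hR₂ _)
  obtain ⟨t₁, ht₁, e₁⟩ := exists_ge_eq_of_tendsto h₁.continuous_R (min_le_left _ _) hr₁ hmin
  obtain ⟨t₂, ht₂, e₂⟩ := exists_ge_eq_of_tendsto h₂.continuous_R (min_le_right _ _) hr₂ hmin
  refine ⟨t₁, t₂, ?_, e₁.trans e₂.symm⟩
  have := u_eq_of_R_eq (h₁.comp_add_const t₁) (h₂.comp_add_const t₂) (fun _ => hR₁ _)
    (fun _ => hR₂ _) (fun t ht => (hT₁ _ (by linarith)).1) (fun t ht => (hT₂ _ (by linarith)).1)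
    (fun t ht => (hT₁ _ (by linarith)).2) (fun t ht => (hT₂ _ (by linarith)).2)
    (hu₁.comp (tendsto_atTop_add_const_right _ t₁ tendsto_id))
    (hu₂.comp (tendsto_atTop_add_const_right _ t₂ tendsto_id))
    (by simpa using e₁.trans e₂.symm)
  simpa using this

end RedSol

/-! ### Existence of an interior orbit that ends at `PW⁰`. -/

theorem one_third_lt_RT : (1 / 3 : ℝ) < √5 / (3 * √3) := by
  rw [lt_div_iff₀ (by positivity)]
  have : √3 < √5 := Real.sqrt_lt_sqrt (by norm_num) (by norm_num)
  linarith

namespace RedSol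

variable {u R A : ℝ → ℝ}

theorem tendsto_u {l : Filter ℝ} {p : State}
    (h : Tendsto (fun t => hoPoint (u t) (R t) (A t)) l (𝓝 p)) : Tendsto u l (𝓝 (p 2)) :=
  ((continuous_apply (2 : Fin 7)).tendsto p).comp h

theorem tendsto_R {l : Filter ℝ} {p : State}
    (h : Tendsto (fun t => hoPoint (u t) (R t) (A t)) l (𝓝 p)) : Tendsto R l (𝓝 (p 3)) :=
  ((continuous_apply (3 : Fin 7)).tendsto p).comp h

/-- An interior solution through `Σ₃ = 3/2` with small `R₁`, followed backwards until
`R₁ = 1/3`. -/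
theorem exists_passing_PW0 (n : ℕ) : ∃ u R A : ℝ → ℝ, RedSol u R A ∧ R 0 = 1 / 3 ∧
    ∀ t, t ≤ (Real.log (n + 4) - Real.log 3) / 4 → u t ≤ 3 / 2 := by
  have hn : (0 : ℝ) < n + 4 := by positivity
  have hn4 : 1 / ((n : ℝ) + 4) ≤ 1 / 4 :=
    one_div_le_one_div_of_le (by norm_num) (by linarith [n.cast_nonneg (α := ℝ)])
  have hn0 : 0 < 1 / ((n : ℝ) + 4) := by positivity
  have hA : 0 < 1 / 4 - (1 / ((n : ℝ) + 4)) ^ 2 := by nlinarith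
  -- The shift by `4` keeps `R₀` below `1/3` and, since `u²/3 = 3/4`, leaves `A₀² = 1/4 - R₀²`
  -- positive.
  obtain ⟨u, R, A, h, hu0, hR0, hA0⟩ := exists_redSol (u₀ := 3 / 2) (R₀ := 1 / ((n : ℝ) + 4))
    (A₀ := √(1 / 4 - (1 / ((n : ℝ) + 4)) ^ 2)) (by rw [Real.sq_sqrt hA.le]; ring) hn0.le
    (Real.sqrt_nonneg _)
  have hRpos := h.R_pos (s := 0) (by rw [hR0]; exact hn0)
  have hApos := h.A_pos (s := 0) (by rw [hA0]; exact Real.sqrt_pos.2 hA)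
  obtain ⟨s, hs0, hs⟩ : ∃ s, s ≤ 0 ∧ R s = 1 / 3 := by
    have hlim := tendsto_R (h.tendsto_RT_atBot hRpos hApos)
    obtain ⟨s, hs, hsR⟩ := ((eventually_le_atBot (0 : ℝ)).and
      (hlim.eventually (lt_mem_nhds one_third_lt_RT))).exists
    obtain ⟨t, ht, htR⟩ := intermediate_value_Icc' hs h.continuous_R.continuousOn
      (show (1 / 3 : ℝ) ∈ Set.Icc (R 0) (R s) from ⟨by rw [hR0]; linarith, hsR.le⟩)
    exact ⟨t, ht.2, htR⟩
  refine ⟨_, _, _, h.comp_add_const s, by simpa using hs, fun t ht => ?_⟩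
  by_contra! hlt
  -- `log R` falls at rate at most `4`, so the passage from `R = 1/3` to `1/(n + 4)` takes at least
  -- the stated time; `u > 3/2` earlier would persist up to time `0`.
  have h1 := add_mul_le_of_le_deriv (c := -4) (h.hasDerivAt_log_R hRpos) hs0 fun τ _ _ => by
    linarith [sq_nonneg (A τ), (abs_le.1 (h.abs_u_le τ)).2]
  rw [hs, hR0, one_div, one_div, Real.log_inv, Real.log_inv] at h1
  rcases (show t + s ≤ 0 by linarith).eq_or_lt with h2 | h2
  · rw [h2, hu0] at hlt
    exact lt_irrefl _ hlt
  · exact (h.three_halves_lt_of_le hRpos hlt.le h2).ne' hu0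

/-- There is an interior solution that converges to `PW⁰`. -/
theorem exists_tendsto_PW0 : ∃ u R A : ℝ → ℝ, RedSol u R A ∧ (∀ t, 0 < R t) ∧ (∀ t, 0 < A t) ∧
    Tendsto (fun t => hoPoint (u t) (R t) (A t)) atTop (𝓝 PW0) := by
  choose u R A h hR0 hle using exists_passing_PW0
  set K : Set (ℝ × ℝ × ℝ) := Set.Icc (-2 : ℝ) 2 ×ˢ Set.Icc (-1 : ℝ) 1 ×ˢ Set.Icc (-1 : ℝ) 1
  have hK : IsCompact K := isCompact_Icc.prod (isCompact_Icc.prod isCompact_Icc)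
  -- The times for which `u ≤ 3/2` is known grow without bound, so the solution from a limit of the
  -- starting points keeps `u ≤ 3/2` for all `t ≥ 0`.
  obtain ⟨⟨a, b, c⟩, -, φ, hφ, hlim⟩ := hK.tendsto_subseq fun n => (h n).mem_box 0
  have ha : Tendsto (fun n => u (φ n) 0) atTop (𝓝 a) := (continuous_fst.tendsto _).comp hlim
  have hb : Tendsto (fun n => R (φ n) 0) atTop (𝓝 b) :=
    ((continuous_fst.comp continuous_snd).tendsto _).comp hlim
  have hc : Tendsto (fun n => A (φ n) 0) atTop (𝓝 c) :=
    ((continuous_snd.comp continuous_snd).tendsto _).comp hlim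
  have hb' : b = 1 / 3 :=
    tendsto_nhds_unique (hb.congr fun n => hR0 (φ n)) tendsto_const_nhds
  have hc0 : 0 ≤ c := ge_of_tendsto' hc fun n => (h (φ n)).A_nonneg 0
  have hcon : a ^ 2 / 3 + b ^ 2 + c ^ 2 = 1 := tendsto_nhds_unique
    (((((ha.pow 2).div_const 3).add (hb.pow 2)).add (hc.pow 2)).congr fun n => (h (φ n)).con 0)
    tendsto_const_nhds
  obtain ⟨v, S, B, g, hv0, hS0, hB0⟩ := exists_redSol hcon (by rw [hb']; norm_num) hc0
  have hvle : ∀ t, 0 ≤ t → v t ≤ 3 / 2 := fun t ht => by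
    have h1 := tendsto_of_hasDerivAt_of_isCompact contDiff_vectorField
      (hK.image continuous_hoPoint)
      (x := fun n t => hoPoint (u (φ n) t) (R (φ n) t) (A (φ n) t))
      (fun n => (h (φ n)).isHOSolution.1) (fun n t => ⟨_, (h (φ n)).mem_box t, rfl⟩)
      g.isHOSolution.1 (fun t => ⟨_, g.mem_box t, rfl⟩)
      (by rw [hv0, hS0, hB0]; exact tendsto_hoPoint ha hb hc) ht
    have h2 : Tendsto (fun n => u (φ n) t) atTop (𝓝 (v t)) :=
      ((continuous_apply (2 : Fin 7)).tendsto _).comp h1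
    refine le_of_tendsto h2 ?_
    have h3 : Tendsto (fun n : ℕ => (Real.log ((φ n : ℕ) + 4) - Real.log 3) / 4) atTop atTop :=
      (tendsto_atTop_add_const_right _ _ (Real.tendsto_log_atTop.comp
        (tendsto_atTop_add_const_right _ _
          (tendsto_natCast_atTop_atTop.comp hφ.tendsto_atTop)))).atTop_div_const (by norm_num)
    filter_upwards [h3.eventually_ge_atTop t] with n hn using hle (φ n) t hn
  have hnot : ¬ Tendsto (fun t => hoPoint (v t) (S t) (B t)) atTop (𝓝 KMinus) := fun hT => by
    have h1 : √3 ≤ 3 / 2 := by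
      refine le_of_tendsto (tendsto_u hT) ?_
      filter_upwards [eventually_ge_atTop 0] with t ht using hvle t ht
    exact absurd h1 (not_le.2 three_halves_lt_sqrt_three)
  have hS := g.R_pos (s := 0) (by rw [hS0, hb']; norm_num)
  -- If `A` vanished, the solution would lie on the edge that ends at `K₋`.
  have hB := g.A_pos (s := 0) (by
    refine lt_of_le_of_ne (g.A_nonneg 0) fun hB => hnot ?_
    exact (g.tendsto_of_A_eq_zero (g.A_eq_zero hB.symm) hS).2)
  refine ⟨v, S, B, g, hS, hB, g.tendsto_PW0 hS hB ⟨0, fun hRT => ?_⟩ fun t => ?_⟩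
  · have h1 : S 0 = √5 / (3 * √3) := congrFun hRT 3
    rw [hS0, hb'] at h1
    exact one_third_lt_RT.ne h1
  · by_contra! hge
    exact hnot (g.tendsto_KMinus_of_le hS hge)

end RedSol

/-! ### The fixed points. -/

theorem vectorField_RT : vectorField RT = 0 := by
  have h1 : (√5 / (3 * √3)) ^ 2 = (5 / 27 : ℝ) := by
    rw [div_pow, mul_pow, Real.sq_sqrt (by norm_num), Real.sq_sqrt (by norm_num)]
    norm_num
  have h2 : √(2 / 3) ^ 2 = (2 / 3 : ℝ) := Real.sq_sqrt (by norm_num)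
  rw [RT_eq, vectorField_hoPoint (by rw [h1, h2]; norm_num), h1, h2]
  ext i
  fin_cases i <;> norm_num

theorem vectorField_PW0 : vectorField PW0 = 0 := by
  rw [PW0_eq, vectorField_hoPoint (by norm_num)]
  ext i
  fin_cases i <;> norm_num

theorem vectorField_KPlus : vectorField KPlus = 0 := by
  rw [KPlus_eq, vectorField_hoPoint (by rw [neg_sq, Real.sq_sqrt (by norm_num)]; norm_num)]
  ext i
  fin_cases i <;> norm_num

theorem vectorField_KMinus : vectorField KMinus = 0 := by
  rw [KMinus_eq, vectorField_hoPoint (by rw [Real.sq_sqrt (by norm_num)]; norm_num)]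
  ext i
  fin_cases i <;> norm_num

theorem RT_mem_HO : RT ∈ HO := mem_HO_iff.2 ⟨_, _, _, by
  rw [div_pow √5, mul_pow, Real.sq_sqrt (by norm_num), Real.sq_sqrt (by norm_num),
    Real.sq_sqrt (by norm_num)]
  norm_num, by positivity, by positivity, RT_eq⟩

theorem PW0_mem_HO : PW0 ∈ HO := mem_HO_iff.2 ⟨_, _, _, by norm_num, le_rfl, by norm_num, PW0_eq⟩

theorem KPlus_mem_HO : KPlus ∈ HO := mem_HO_iff.2 ⟨_, _, _, by
  rw [neg_sq, Real.sq_sqrt (by norm_num)]; norm_num, le_rfl, le_rfl, KPlus_eq⟩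

theorem KMinus_mem_HO : KMinus ∈ HO := mem_HO_iff.2 ⟨_, _, _, by
  rw [Real.sq_sqrt (by norm_num)]; norm_num, le_rfl, le_rfl, KMinus_eq⟩

theorem eq_Kasner_of_eq_zero {u : ℝ} (h : u ^ 2 / 3 + 0 ^ 2 + 0 ^ 2 = (1 : ℝ)) :
    hoPoint u 0 0 = KPlus ∨ hoPoint u 0 0 = KMinus := by
  have h3 : √3 ^ 2 = (3 : ℝ) := Real.sq_sqrt (by norm_num)
  have : (u - √3) * (u + √3) = 0 := by linear_combination 3 * h - h3
  rcases mul_eq_zero.1 this with h' | h'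
  · right
    rw [KMinus_eq, sub_eq_zero.1 h']
  · left
    rw [KPlus_eq, eq_neg_of_add_eq_zero_left h']

theorem eq_PW0_of_eq_three_halves {A : ℝ} (h : (3 / 2) ^ 2 / 3 + 0 ^ 2 + A ^ 2 = (1 : ℝ))
    (hA : 0 ≤ A) : hoPoint (3 / 2) 0 A = PW0 := by
  have : A = 1 / 2 := (sq_eq_sq₀ hA (by norm_num)).1 (by linarith)
  rw [PW0_eq, this]

theorem fixedPoints_eq : {p | p ∈ HO ∧ vectorField p = 0} = {RT, PW0, KPlus, KMinus} := by
  ext p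
  simp only [Set.mem_ofPred_eq, Set.mem_insert_iff, Set.mem_singleton_iff]
  constructor
  · rintro ⟨hp, hv⟩
    obtain ⟨u, R, A, h, hR, hA, rfl⟩ := mem_HO_iff.1 hp
    rw [vectorField_hoPoint h] at hv
    have e1 : 2 * A ^ 2 * u + 6 * R ^ 2 - 3 * A ^ 2 = 0 := congrFun hv 2
    have e2 : (2 * A ^ 2 - 2 * u) * R = 0 := congrFun hv 3
    have e3 : (2 * A ^ 2 + u - 2) * A = 0 := congrFun hv 6
    rcases hR.eq_or_lt with rfl | hR
    · rcases hA.eq_or_lt with rfl | hA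
      · exact Or.inr (Or.inr (eq_Kasner_of_eq_zero h))
      · have e4 : A ^ 2 * (2 * u - 3) = 0 := by linear_combination e1
        rcases mul_eq_zero.1 e4 with e5 | e5
        · exact absurd e5 (by positivity)
        · obtain rfl : u = 3 / 2 := by linarith
          exact Or.inr (Or.inl (eq_PW0_of_eq_three_halves h hA.le))
    · rcases hA.eq_or_lt with rfl | hA
      · exact absurd (show R ^ 2 = 0 by linarith) (by positivity)
      · left
        have e4 := (mul_eq_zero.1 e2).resolve_right hR.ne'
        have e5 := (mul_eq_zero.1 e3).resolve_right hA.ne'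
        obtain rfl : u = 2 / 3 := by linarith
        have e6 : A = √(2 / 3) := (Real.sqrt_eq_iff_eq_sq (by norm_num) hA.le).2 (by linarith) |>.symm
        have e7 : R = √5 / (3 * √3) := by
          refine (sq_eq_sq₀ hR.le (by positivity)).1 ?_
          rw [div_pow, mul_pow, Real.sq_sqrt (by norm_num), Real.sq_sqrt (by norm_num)]
          linarith
        rw [RT_eq, ← e6, ← e7]
  · rintro (rfl | rfl | rfl | rfl)
    exacts [⟨RT_mem_HO, vectorField_RT⟩, ⟨PW0_mem_HO, vectorField_PW0⟩,
      ⟨KPlus_mem_HO, vectorField_KPlus⟩, ⟨KMinus_mem_HO, vectorField_KMinus⟩]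

/-! ### Orbits, limit sets and the classification of solutions. -/

theorem IsSolution.eq_of_eq {x y : ℝ → State} (hx : IsSolution x) (hy : IsSolution y) {t : ℝ}
    (h : x t = y t) : x = y :=
  eq_of_hasDerivAt_of_contDiff contDiff_vectorField hx hy h

theorem IsSolution.comp_add_const {x : ℝ → State} (hx : IsSolution x) (s : ℝ) :
    IsSolution fun t => x (t + s) := fun t => (hx (t + s)).comp_add_const t s

theorem IsSolution.range_eq {x y : ℝ → State} (hx : IsSolution x) (hy : IsSolution y) {s t : ℝ}
    (h : x s = y t) : Set.range x = Set.range y := by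
  have h1 : (fun τ => x (τ + s)) = fun τ => y (τ + t) :=
    (hx.comp_add_const s).eq_of_eq (hy.comp_add_const t) (t := 0) (by simpa using h)
  ext p
  constructor
  · rintro ⟨τ, rfl⟩
    exact ⟨τ - s + t, by simpa using (congrFun h1 (τ - s)).symm⟩
  · rintro ⟨τ, rfl⟩
    exact ⟨τ - t + s, by simpa using congrFun h1 (τ - t)⟩

theorem IsSolution.eq_const {x : ℝ → State} (hx : IsSolution x) {t : ℝ}
    (h : vectorField (x t) = 0) (s : ℝ) : x s = x t :=
  congrFun (hx.eq_of_eq (y := fun _ => x t) (fun τ => by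
    rw [h]
    exact hasDerivAt_const τ _) (t := t) rfl) s

theorem exists_isHOSolution {p : State} (hp : p ∈ HO) : ∃ x, IsHOSolution x ∧ x 0 = p := by
  obtain ⟨u₀, R₀, A₀, h, hR, hA, rfl⟩ := mem_HO_iff.1 hp
  obtain ⟨u, R, A, g, hu0, hR0, hA0⟩ := exists_redSol h hR hA
  exact ⟨_, g.isHOSolution, by rw [hu0, hR0, hA0]⟩

/-- The solutions in `HO`: fixed points, the three types of boundary orbits, and the interior
orbits with their two possible future limits. -/
theorem IsHOSolution.classification {x : ℝ → State} (hx : IsHOSolution x) :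
    (∀ t, vectorField (x t) = 0 ∧ x t = x 0) ∨
    (((∀ t, 0 < x t 3) ∧ ∀ t, x t 6 = 0) ∧
      Tendsto x atBot (𝓝 KPlus) ∧ Tendsto x atTop (𝓝 KMinus)) ∨
    (((∀ t, x t 3 = 0) ∧ ∀ t, 0 < x t 6) ∧
      Tendsto x atBot (𝓝 PW0) ∧ Tendsto x atTop (𝓝 KPlus)) ∨
    (((∀ t, x t 3 = 0) ∧ ∀ t, 0 < x t 6) ∧
      Tendsto x atBot (𝓝 PW0) ∧ Tendsto x atTop (𝓝 KMinus)) ∨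
    (((∀ t, 0 < x t 3) ∧ ∀ t, 0 < x t 6) ∧
      Tendsto x atBot (𝓝 RT) ∧ Tendsto x atTop (𝓝 PW0)) ∨
    (((∀ t, 0 < x t 3) ∧ ∀ t, 0 < x t 6) ∧
      Tendsto x atBot (𝓝 RT) ∧ Tendsto x atTop (𝓝 KMinus)) := by
  obtain ⟨h, hx'⟩ := hx.redSol
  have hfix : ∀ {t}, vectorField (x t) = 0 → ∀ s, vectorField (x s) = 0 ∧ x s = x 0 :=
    fun ht s => by
      rw [hx.1.eq_const ht s, hx.1.eq_const ht 0]
      exact ⟨ht, rfl⟩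
  have hxe : x = fun t => hoPoint (x t 2) (x t 3) (x t 6) := funext hx'
  have hc0 := h.con 0
  have hx0 := hx' 0
  rcases (h.R_nonneg 0).eq_or_lt with hR | hR
  · have hR' := h.R_eq_zero hR.symm
    simp only [← hR] at hc0 hx0
    rcases (h.A_nonneg 0).eq_or_lt with hA | hA
    · left
      simp only [← hA] at hc0 hx0
      rcases eq_Kasner_of_eq_zero hc0 with hK | hK
      · exact hfix (t := 0) (by rw [hx0, hK, vectorField_KPlus])
      · exact hfix (t := 0) (by rw [hx0, hK, vectorField_KMinus])
    · have hA' := h.A_pos hA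
      rcases lt_trichotomy (x 0 2) (3 / 2) with hu | hu | hu
      · have hT := h.tendsto_of_R_eq_zero_of_lt hR' hA' hu
        rw [← hxe] at hT
        exact Or.inr (Or.inr (Or.inl ⟨⟨hR', hA'⟩, hT⟩))
      · left
        rw [hu] at hc0 hx0
        exact hfix (t := 0) (by rw [hx0, eq_PW0_of_eq_three_halves hc0 hA.le, vectorField_PW0])
      · have hT := h.tendsto_of_R_eq_zero_of_gt hR' hA' hu
        rw [← hxe] at hT
        exact Or.inr (Or.inr (Or.inr (Or.inl ⟨⟨hR', hA'⟩, hT⟩)))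
  · have hR' := h.R_pos hR
    rcases (h.A_nonneg 0).eq_or_lt with hA | hA
    · have hA' := h.A_eq_zero hA.symm
      have hT := h.tendsto_of_A_eq_zero hA' hR'
      rw [← hxe] at hT
      exact Or.inr (Or.inl ⟨⟨hR', hA'⟩, hT⟩)
    · have hA' := h.A_pos hA
      have hα := h.tendsto_RT_atBot hR' hA'
      rw [← hxe] at hα
      by_cases hne : ∃ t, hoPoint (x t 2) (x t 3) (x t 6) ≠ RT
      · by_cases hu : ∀ t, x t 2 < 3 / 2
        · have hω := h.tendsto_PW0 hR' hA' hne hu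
          rw [← hxe] at hω
          exact Or.inr (Or.inr (Or.inr (Or.inr (Or.inl ⟨⟨hR', hA'⟩, hα, hω⟩))))
        · push Not at hu
          obtain ⟨t, ht⟩ := hu
          have hω := h.tendsto_KMinus_of_le hR' ht
          rw [← hxe] at hω
          exact Or.inr (Or.inr (Or.inr (Or.inr (Or.inr ⟨⟨hR', hA'⟩, hα, hω⟩))))
      · push Not at hne
        exact Or.inl (hfix (t := 0) (by rw [hx' 0, hne 0, vectorField_RT]))

theorem limitSets_eq_of_tendsto {x : ℝ → State} {p q : State} (hp : Tendsto x atBot (𝓝 p))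
    (hq : Tendsto x atTop (𝓝 q)) : alphaLimitSet x = {p} ∧ omegaLimitSet x = {q} :=
  ⟨setOf_mapClusterPt_eq_singleton hp, setOf_mapClusterPt_eq_singleton hq⟩

theorem IsHOSolution.isHOConnection {x : ℝ → State} (hx : IsHOSolution x) {p q : State}
    (hp : Tendsto x atBot (𝓝 p)) (hq : Tendsto x atTop (𝓝 q)) :
    IsHOConnection p q (Set.range x) :=
  ⟨x, hx, rfl, limitSets_eq_of_tendsto hp hq⟩

/-- Since every solution converges at both ends, a statement about limit sets can be turned into one
about limits. -/
theorem IsHOSolution.exists_tendsto {x : ℝ → State} (hx : IsHOSolution x) :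
    ∃ p q, Tendsto x atBot (𝓝 p) ∧ Tendsto x atTop (𝓝 q) := by
  rcases hx.classification with h | h | h | h | h | h
  · rw [show x = fun _ => x 0 from funext fun t => (h t).2]
    exact ⟨_, _, tendsto_const_nhds, tendsto_const_nhds⟩
  all_goals exact ⟨_, _, h.2⟩

/-- A type of connection is realized by a single orbit if all the solutions of this type meet a
given one. -/
theorem isHOConnection_iff_eq_range {x : ℝ → State} (hx : IsHOSolution x) {p q : State}
    (hp : Tendsto x atBot (𝓝 p)) (hq : Tendsto x atTop (𝓝 q))
    (hmeet : ∀ y, IsHOSolution y → Tendsto y atBot (𝓝 p) → Tendsto y atTop (𝓝 q) →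
      ∃ s t, y s = x t) (O : Set State) : IsHOConnection p q O ↔ O = Set.range x := by
  constructor
  · rintro ⟨y, hy, rfl, hα, hω⟩
    obtain ⟨p', q', hp', hq'⟩ := hy.exists_tendsto
    obtain ⟨hα', hω'⟩ := limitSets_eq_of_tendsto hp' hq'
    obtain rfl : p' = p := Set.singleton_eq_singleton_iff.1 (hα'.symm.trans hα)
    obtain rfl : q' = q := Set.singleton_eq_singleton_iff.1 (hω'.symm.trans hω)
    obtain ⟨s, t, hst⟩ := hmeet y hy hp' hq'
    exact hy.1.range_eq hx.1 hst
  · rintro rfl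
    exact hx.isHOConnection hp hq

theorem tendsto_apply_two {x : ℝ → State} {l : Filter ℝ} {p : State} (h : Tendsto x l (𝓝 p)) :
    Tendsto (fun t => x t 2) l (𝓝 (p 2)) := ((continuous_apply (2 : Fin 7)).tendsto p).comp h

/-- The values of `Σ₃` at the four fixed points are distinct, so this coordinate alone tells their
limits apart. -/
theorem eq_of_tendsto_of_tendsto {x : ℝ → State} {l : Filter ℝ} [l.NeBot] {p q : State}
    (hp : Tendsto x l (𝓝 p)) (hq : Tendsto x l (𝓝 q)) : p 2 = q 2 := by
  rw [tendsto_nhds_unique hp hq]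

theorem exists_apply_two_eq {x : ℝ → State} (hx : IsSolution x) {p q : State} {c : ℝ}
    (hp : Tendsto x atBot (𝓝 p)) (hq : Tendsto x atTop (𝓝 q))
    (hc : p 2 < c ∧ c < q 2 ∨ q 2 < c ∧ c < p 2) : ∃ t, x t 2 = c := by
  have hcont : Continuous fun t => x t 2 := continuous_iff_continuousAt.2 fun t =>
    (hasDerivAt_pi.1 (hx t) 2).continuousAt
  have hp' := tendsto_apply_two hp
  have hq' := tendsto_apply_two hq
  rcases hc with ⟨h1, h2⟩ | ⟨h1, h2⟩
  · exact mem_range_of_exists_le_of_exists_ge hcont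
      ((hp'.eventually (gt_mem_nhds h1)).exists.imp fun _ => le_of_lt)
      ((hq'.eventually (lt_mem_nhds h2)).exists.imp fun _ => le_of_lt)
  · exact mem_range_of_exists_le_of_exists_ge hcont
      ((hq'.eventually (gt_mem_nhds h1)).exists.imp fun _ => le_of_lt)
      ((hp'.eventually (lt_mem_nhds h2)).exists.imp fun _ => le_of_lt)

theorem RT_two : RT 2 = 2 / 3 := rfl
theorem PW0_two : PW0 2 = 3 / 2 := rfl
theorem KPlus_two : KPlus 2 = -√3 := rfl
theorem KMinus_two : KMinus 2 = √3 := rfl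

/-- A solution that runs from one of the four fixed points to a different one is of the type
given by its limits. -/
theorem IsHOSolution.signs {x : ℝ → State} (hx : IsHOSolution x) :
    (Tendsto x atBot (𝓝 KPlus) → Tendsto x atTop (𝓝 KMinus) → ∀ t, x t 6 = 0) ∧
    (Tendsto x atBot (𝓝 PW0) → Tendsto x atTop (𝓝 KPlus) → ∀ t, x t 3 = 0) ∧
    (Tendsto x atBot (𝓝 PW0) → Tendsto x atTop (𝓝 KMinus) → ∀ t, x t 3 = 0) ∧
    (Tendsto x atBot (𝓝 RT) → Tendsto x atTop (𝓝 PW0) → ∀ t, 0 < x t 3) := by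
  have h3 := three_halves_lt_sqrt_three
  rcases hx.classification with h | ⟨⟨h1, h2⟩, h⟩ | ⟨⟨h1, h2⟩, h⟩ | ⟨⟨h1, h2⟩, h⟩ |
    ⟨⟨h1, h2⟩, h⟩ | ⟨⟨h1, h2⟩, h⟩
  · have hb : Tendsto x atBot (𝓝 (x 0)) := by
      rw [show x = fun _ => x 0 from funext fun t => (h t).2]
      exact tendsto_const_nhds
    have ht : Tendsto x atTop (𝓝 (x 0)) := by
      rw [show x = fun _ => x 0 from funext fun t => (h t).2]
      exact tendsto_const_nhds
    refine ⟨?_, ?_, ?_, ?_⟩ <;> intro hp hq <;> exfalso <;>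
    · have e1 := eq_of_tendsto_of_tendsto hb hp
      have e2 := eq_of_tendsto_of_tendsto ht hq
      simp only [RT_two, PW0_two, KPlus_two, KMinus_two] at e1 e2
      linarith
  all_goals
    refine ⟨?_, ?_, ?_, ?_⟩ <;> intro hp hq <;> first
      | assumption
      | exfalso
        have e1 := eq_of_tendsto_of_tendsto h.1 hp
        have e2 := eq_of_tendsto_of_tendsto h.2 hq
        simp only [RT_two, PW0_two, KPlus_two, KMinus_two] at e1 e2
        linarith

theorem IsHOSolution.mem_coords {x : ℝ → State} (hx : IsHOSolution x) (t : ℝ) :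
    x t 2 ^ 2 / 3 + x t 3 ^ 2 + x t 6 ^ 2 = 1 ∧ 0 ≤ x t 3 ∧ 0 ≤ x t 6 :=
  ⟨hx.redSol.1.con t, hx.redSol.1.R_nonneg t, hx.redSol.1.A_nonneg t⟩

/-- Points of `HO` are determined by two of their coordinates. -/
theorem eq_of_apply_eq {x y : ℝ → State} (hx : IsHOSolution x) (hy : IsHOSolution y) {s t : ℝ}
    (h2 : x s 2 = y t 2) (h : x s 3 = y t 3 ∨ x s 6 = y t 6) : x s = y t := by
  obtain ⟨a1, a2, a3⟩ := hx.mem_coords s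
  obtain ⟨b1, b2, b3⟩ := hy.mem_coords t
  rw [h2] at a1
  have h36 : x s 3 = y t 3 ∧ x s 6 = y t 6 := by
    rcases h with h | h
    · rw [h] at a1
      exact ⟨h, (sq_eq_sq₀ a3 b3).1 (by linarith)⟩
    · rw [h] at a1
      exact ⟨(sq_eq_sq₀ a2 b2).1 (by linarith), h⟩
  rw [hx.redSol.2 s, hy.redSol.2 t, h2, h36.1, h36.2]

/-! ### The four exceptional heteroclinic orbits. -/

/-- The orbit from `K₊` to `K₋`. -/
theorem exists_orbit_KPlus_KMinus : ∃ O ⊆ HOBoundary, ∀ O', IsHOConnection KPlus KMinus O' ↔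
    O' = O := by
  obtain ⟨x, hx, hx0⟩ := exists_isHOSolution (p := hoPoint 0 1 0)
    (mem_HO_iff.2 ⟨_, _, _, by norm_num, by norm_num, le_rfl, rfl⟩)
  have h := hx.redSol.1
  have hA := h.A_eq_zero (s := 0) (by rw [hx0]; rfl)
  have hR := h.R_pos (s := 0) (by rw [hx0]; exact one_pos)
  have hT := h.tendsto_of_A_eq_zero hA hR
  rw [← funext hx.redSol.2] at hT
  refine ⟨Set.range x, ?_, isHOConnection_iff_eq_range hx hT.1 hT.2 fun y hy hp hq => ?_⟩
  · rintro _ ⟨t, rfl⟩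
    exact ⟨hx.2 t, Or.inr (hA t)⟩
  · have h3 : (0 : ℝ) < √3 := by positivity
    obtain ⟨t, ht⟩ := exists_apply_two_eq hy.1 (c := 0) hp hq
      (by rw [KPlus_two, KMinus_two]; exact Or.inl ⟨by linarith, h3⟩)
    refine ⟨t, 0, eq_of_apply_eq hy hx (by rw [ht, hx0]; rfl) (Or.inr ?_)⟩
    exact (hy.signs.1 hp hq t).trans (hA 0).symm

/-- The orbit from `PW⁰` to `K₊`. -/
theorem exists_orbit_PW0_KPlus : ∃ O ⊆ HOBoundary, ∀ O', IsHOConnection PW0 KPlus O' ↔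
    O' = O := by
  obtain ⟨x, hx, hx0⟩ := exists_isHOSolution (p := hoPoint 0 0 1)
    (mem_HO_iff.2 ⟨_, _, _, by norm_num, le_rfl, by norm_num, rfl⟩)
  have h := hx.redSol.1
  have hR := h.R_eq_zero (s := 0) (by rw [hx0]; rfl)
  have hA := h.A_pos (s := 0) (by rw [hx0]; exact one_pos)
  have hT := h.tendsto_of_R_eq_zero_of_lt hR hA
    (by rw [hx0]; exact (show (0 : ℝ) < 3 / 2 by norm_num))
  rw [← funext hx.redSol.2] at hT
  refine ⟨Set.range x, ?_, isHOConnection_iff_eq_range hx hT.1 hT.2 fun y hy hp hq => ?_⟩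
  · rintro _ ⟨t, rfl⟩
    exact ⟨hx.2 t, Or.inl (hR t)⟩
  · have h3 : (0 : ℝ) < √3 := by positivity
    obtain ⟨t, ht⟩ := exists_apply_two_eq hy.1 (c := 0) hp hq
      (by rw [KPlus_two, PW0_two]; exact Or.inr ⟨by linarith, by norm_num⟩)
    refine ⟨t, 0, eq_of_apply_eq hy hx (by rw [ht, hx0]; rfl) (Or.inl ?_)⟩
    exact (hy.signs.2.1 hp hq t).trans (hR 0).symm

/-- The orbit from `PW⁰` to `K₋`. -/
theorem exists_orbit_PW0_KMinus : ∃ O ⊆ HOBoundary, ∀ O', IsHOConnection PW0 KMinus O' ↔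
    O' = O := by
  -- `8/5` is a convenient value of `Σ₃` between `3/2` and `√3`, which every such orbit must take;
  -- then `A² = 1 - 64/75 = 11/75`.
  have h85 : (8 / 5 : ℝ) < √3 := by
    rw [Real.lt_sqrt (by norm_num)]
    norm_num
  obtain ⟨x, hx, hx0⟩ := exists_isHOSolution (p := hoPoint (8 / 5) 0 √(11 / 75))
    (mem_HO_iff.2 ⟨_, _, _, by rw [Real.sq_sqrt (by norm_num)]; norm_num, le_rfl, by positivity,
      rfl⟩)
  have h := hx.redSol.1
  have hR := h.R_eq_zero (s := 0) (by rw [hx0]; rfl)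
  have hA := h.A_pos (s := 0)
    (by rw [hx0]; exact (show (0 : ℝ) < √(11 / 75) by positivity))
  have hT := h.tendsto_of_R_eq_zero_of_gt hR hA
    (by rw [hx0]; exact (show (3 / 2 : ℝ) < 8 / 5 by norm_num))
  rw [← funext hx.redSol.2] at hT
  refine ⟨Set.range x, ?_, isHOConnection_iff_eq_range hx hT.1 hT.2 fun y hy hp hq => ?_⟩
  · rintro _ ⟨t, rfl⟩
    exact ⟨hx.2 t, Or.inl (hR t)⟩
  · obtain ⟨t, ht⟩ := exists_apply_two_eq hy.1 (c := 8 / 5) hp hq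
      (by rw [KMinus_two, PW0_two]; exact Or.inl ⟨by norm_num, h85⟩)
    refine ⟨t, 0, eq_of_apply_eq hy hx (by rw [ht, hx0]; rfl) (Or.inl ?_)⟩
    exact (hy.signs.2.2.1 hp hq t).trans (hR 0).symm

/-- The orbit from `RT` to `PW⁰`. -/
theorem exists_orbit_RT_PW0 : ∃ O ⊆ HOInterior, ∀ O', IsHOConnection RT PW0 O' ↔ O' = O := by
  obtain ⟨u, R, A, h, hR, hA, hω⟩ := RedSol.exists_tendsto_PW0
  refine ⟨Set.range fun t => hoPoint (u t) (R t) (A t), ?_,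
    isHOConnection_iff_eq_range h.isHOSolution (h.tendsto_RT_atBot hR hA) hω
      fun y hy hp hq => ?_⟩
  · rintro _ ⟨t, rfl⟩
    exact ⟨h.isHOSolution.2 t, hR t, hA t⟩
  · obtain ⟨s, t, e1, e2⟩ := hy.redSol.1.exists_eq_of_tendsto_PW0 h (hy.signs.2.2.2 hp hq) hR
      (tendsto_apply_two hq) (RedSol.tendsto_u hω)
      (((continuous_apply (3 : Fin 7)).tendsto PW0).comp hq) (RedSol.tendsto_R hω)
    exact ⟨s, t, eq_of_apply_eq hy h.isHOSolution e1 (Or.inl e2)⟩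

end BianchiVI

theorem lemma2p4 :
    -- `HO` is invariant, and exactly one global solution passes through each of its points
    (∀ p ∈ BianchiVI.HO, ∃ x : ℝ → BianchiVI.State,
      BianchiVI.IsHOSolution x ∧ x 0 = p ∧
        ∀ y : ℝ → BianchiVI.State, BianchiVI.IsSolution y → y 0 = p → y = x) ∧
    -- the fixed points in `HO`
    {p | p ∈ BianchiVI.HO ∧ BianchiVI.vectorField p = 0} =
      {BianchiVI.RT, BianchiVI.PW0, BianchiVI.KPlus, BianchiVI.KMinus} ∧
    -- the four exceptional heteroclinic orbits, and all the other orbits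
    ∃ O₁ O₂ O₃ O₄ : Set BianchiVI.State,
      (∀ O, BianchiVI.IsHOConnection BianchiVI.KPlus BianchiVI.KMinus O ↔ O = O₁) ∧
      (∀ O, BianchiVI.IsHOConnection BianchiVI.PW0 BianchiVI.KPlus O ↔ O = O₂) ∧
      (∀ O, BianchiVI.IsHOConnection BianchiVI.PW0 BianchiVI.KMinus O ↔ O = O₃) ∧
      (∀ O, BianchiVI.IsHOConnection BianchiVI.RT BianchiVI.PW0 O ↔ O = O₄) ∧
      O₁ ⊆ BianchiVI.HOBoundary ∧ O₂ ⊆ BianchiVI.HOBoundary ∧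
      O₃ ⊆ BianchiVI.HOBoundary ∧ O₄ ⊆ BianchiVI.HOInterior ∧
      ∀ x : ℝ → BianchiVI.State, BianchiVI.IsHOSolution x →
        (∃ t : ℝ, BianchiVI.vectorField (x t) ≠ 0) →
        Set.range x ≠ O₁ → Set.range x ≠ O₂ → Set.range x ≠ O₃ → Set.range x ≠ O₄ →
        BianchiVI.alphaLimitSet x = {BianchiVI.RT} ∧
          BianchiVI.omegaLimitSet x = {BianchiVI.KMinus} := by

  refine ⟨fun p hp => ?_, BianchiVI.fixedPoints_eq, ?_⟩
  · obtain ⟨x, hx, hx0⟩ := BianchiVI.exists_isHOSolution hp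
    exact ⟨x, hx, hx0, fun y hy hy0 => hy.eq_of_eq hx.1 (hy0.trans hx0.symm)⟩
  obtain ⟨O₁, hO₁, h₁⟩ := BianchiVI.exists_orbit_KPlus_KMinus
  obtain ⟨O₂, hO₂, h₂⟩ := BianchiVI.exists_orbit_PW0_KPlus
  obtain ⟨O₃, hO₃, h₃⟩ := BianchiVI.exists_orbit_PW0_KMinus
  obtain ⟨O₄, hO₄, h₄⟩ := BianchiVI.exists_orbit_RT_PW0
  refine ⟨O₁, O₂, O₃, O₄, h₁, h₂, h₃, h₄, hO₁, hO₂, hO₃, hO₄, ?_⟩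
  rintro x hx ⟨t, ht⟩ n₁ n₂ n₃ n₄
  rcases hx.classification with h | ⟨-, h⟩ | ⟨-, h⟩ | ⟨-, h⟩ | ⟨-, h⟩ | ⟨-, h⟩
  · exact absurd (h t).1 ht
  · exact absurd ((h₁ _).1 (hx.isHOConnection h.1 h.2)) n₁
  · exact absurd ((h₂ _).1 (hx.isHOConnection h.1 h.2)) n₂
  · exact absurd ((h₃ _).1 (hx.isHOConnection h.1 h.2)) n₃
  · exact absurd ((h₄ _).1 (hx.isHOConnection h.1 h.2)) n₄
  · exact BianchiVI.limitSets_eq_of_tendsto h.1 h.2
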